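/- **Generators.** A generator is a continuous non-increasing $\psi:[0,\infty]\to[0,1]$ with $\psi(0)=1$, $\psi(\infty)=0$, strictly decreasing on $[0,\inf\{t:\psi(t)=0\}]$; $\psi^-(s)=\inf\{t:\psi(t)=s\}$. A function on $(0,\infty)$ is completely monotonic (c.m.) if it is smooth and $(-1)^k f^{(k)}\ge 0$ on $(0,\infty)$ for all $k\geq 0$. $\Psi_\infty$ is the set of c.m. generators, and $\tilde\Psi^2_\infty$ the set of $(\psi_1,\psi_2)\in\Psi_\infty\times\Psi_\infty$ with $(\psi_1^{-1}\circ\psi_2)'$ c.m. The families are, with $\theta\in\Theta_a$: A: $\frac{1-\theta}{e^t-\theta}$, $[0,1)$; C: $(1+t)^{-1/\theta}$, $(0,\infty)$; 12: $(1+t^{1/\theta})^{-1}$, $[1,\infty)$; 14: $(1+t^{1/\theta})^{-\theta}$, $[1,\infty)$; 19: $\theta/\ln(t+e^\theta)$, $(0,\infty)$; 20: $(\ln(t+e))^{-1/\theta}$, $(0,\infty)$; they are denoted $\psi^{(a,\theta)}$. **Nesting semigroup.** Let $\mathcal F\subseteq\{A,C,12,14,19,20\}$. $\mathcal F_{\mathbb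 R}$ consists of the finite sets $\mathcal N$ of pairs $(a,r)$, $a\in\mathcal F$, $r$ an interval (of any of the four open/closed types, possibly empty) with end points $0\le\alpha\le\beta\le\infty$, $\alpha<\infty$. Put $\mathcal N_1\tilde\cap\mathcal N_2=\{(a,r_1\cap r_2):(a,r_1)\in\mathcal N_1,(a,r_2)\in\mathcal N_2\}$, and $(a,\theta)\tilde\in\mathcal N$ iff $\theta\in r$ for some $(a,r)\in\mathcal N$. $\mathcal N$ is Archimedean if $\theta\in\Theta_a$ and $\psi^{(a,\theta)}\in\Psi_\infty$ for all $(a,\theta)\tilde\in\mathcal N$, and $\mathcal F$-Archimedean if moreover it represents every pair represented by any Archimedean element of $\mathcal F_{\mathbb R}$. Let $\mathcal N_{\mathcal F}$ be $\mathcal F$-Archimedean. $\mathcal N^2_{\mathcal F}$ is a mapping with values in $\mathcal F_{\mathbb R}$ such that for $(a_2,\theta_2)\tilde\in\mathcal N_{\mathcal F}$: $(a_1,\theta_1)\tilde\in\mathcal N^2_{\mathcal F}(a_2,\theta_2)$ iff $(a_1,\theta_1)\tilde\in\mathcal N_{\mathcal F}$, $(\psi^{(a_1,\theta_1)},\psi^{(a_2,\theta_2)})\in\tilde\Psi^2_\infty$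 and $(a_1,a_2)\in\{(A,A),(C,C),(12,12),(19,19),(20,20),(A,C),(A,19),(A,20),(C,12),(C,14),(C,19),(C,20)\}$. **Algorithm.** Inputs: data $U\in\mathbb R^{n\times d}$ with $d\ge2$; $\mathcal N_0\in\mathcal F_{\mathbb R}$; $\mathcal N^2_{\mathcal F}$; a nonnegative goodness-of-fit statistic $S_n$ of two data columns and a bivariate copula; and an aggregation function $g$, i.e. for every $k\ge1$ an exchangeable map $[0,\infty)^k\to[0,\infty)$ with $g(x,\dots,x)=x$. *Structure.* Let $\tau^n_{ij}=\frac4{n(n-1)}\sum_{k<l}\mathbf 1\{(U_{ki}-U_{li})(U_{kj}-U_{lj})>0\}-1$. Start with the active nodes $1,\dots,d$ (leaves), $\downarrow(i)=\{i\}$. For $k=1,\dots,d-1$ choose active $i<j$ maximizing the average of $\tau^n$ over $\downarrow(i)\times\downarrow(j)$, call this average $\hat\tau_{d+k}$, make $i,j$ the children of the new fork $d+k$, replace $i,j$ by $d+k$ among the active nodes, and put $\downarrow(d+k)=\downarrow(i)\cup\downarrow(j)$. *Parameters.* Put $\mathcal N^1(v)=\mathcal N_0$ for each leaf $v$. For $k=1,\dots,d-1$,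 with $i,j$ the children of $d+k$, let $\mathcal N=\mathcal N^1(i)\tilde\cap\mathcal N^1(j)$; stop without result if $\mathcal N$ represents no pair. For each $(a_l,r_l)\in\mathcal N$ with $r_l\neq\emptyset$ let $\hat\theta_l$ be a solution $\theta\in\Theta_{a_l}$ of $\tau_{(a_l)}(\theta)=\hat\tau_{d+k}$, where $\tau_{(a)}(\theta)=1-4\int_0^\infty t\,\big(\tfrac{d}{dt}\psi^{(a,\theta)}(t)\big)^2dt$ (an arbitrary prescribed real number if there is none), and replace it by $\max\{\min\{\hat\theta_l,\beta\},\alpha\}$. Here $\alpha\le\beta$ are the end points of $r_l$, an open end being replaced by a prescribed number in $r_l$, and $\beta=\infty$ (no trimming from above) if $r_l$ is unbounded. Choose $l^*$ minimizing the value of $g$ on the numbers $S_n((U_{\bullet p},U_{\bullet q}),C_{\psi^{(a_l,\hat\theta_l)}})$, $(p,q)\in\downarrow(i)\times\downarrow(j)$, where $C_\psi(u_1,u_2)=\psi(\psi^-(u_1)+\psi^-(u_2))$. Put $\hat\lambda(d+k)=\psi^{(a_{l^*},\hat\theta_{l^*})}$ and $\mathcal N^1(d+k)=\mathcal N\tilde\cap\mathcal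 N^2_{\mathcal F}(a_{l^*},\hat\theta_{l^*})$; stop without result if this represents no pair. Ties are broken arbitrarily. The output is the tree with the labeling $\hat\lambda$ of its forks. **Theorem.** Let $\mathcal N_0\in\mathcal F_{\mathbb R}$ be Archimedean and represent at least one pair, and suppose that for all $(a_2,\theta_2)\tilde\in\mathcal N_0$ and $(a_3,\theta_3)\tilde\in\mathcal N_0$ there are $a_1\in\mathcal F$, $\theta_1\in[0,\infty)$ with $$(a_1,\theta_1)\ \tilde\in\ \mathcal N_0\,\tilde\cap\,\mathcal N^2_{\mathcal F}(a_2,\theta_2)\,\tilde\cap\,\mathcal N^2_{\mathcal F}(a_3,\theta_3).$$ Then, for all data $U$, all $g$ and $S_n$ (and all prescribed numbers and tie-breaking rules), the algorithm does not stop prematurely. It returns a rooted tree with leaves $1,\dots,d$, forks $d+1,\dots,2d-1$, each with at least two children, and root $2d-1$, and a labeling $\hat\lambda$ of the forks by c.m. generators, such that the sufficient nesting condition holds: $(\hat\lambda(v),\hat\lambda(w))\in\tilde\Psi^2_\infty$ whenever the fork $w$ is a child of the fork $v$. Moreover the function $C:[0,1]^d\to[0,1]$, $C(u)=x_{2d-1}$,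 where $x_v=u_v$ for leaves and $x_v=\hat\lambda(v)\big(\sum_{w\text{ child of }v}\hat\lambda(v)^-(x_w)\big)$ for forks $v$, is well defined and a $d$-copula. -/

import Mathlib

open Set
open scoped ENNReal NNReal ContDiff Classical

noncomputable section

namespace HAC

/-! ### Archimedean generators and complete monotonicity -/

/-- `f` is completely monotonic: it is smooth on `(0, ∞)` and `(-1) ^ k * f⁽ᵏ⁾ ≥ 0` there. -/
def CompletelyMonotonic (f : ℝ → ℝ) : Prop :=
  ContDiffOn ℝ ∞ f (Ioi 0) ∧ ∀ k : ℕ, ∀ t : ℝ, 0 < t → 0 ≤ (-1) ^ k * iteratedDeriv k f t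

/-- Archimedean generators `ψ : [0, ∞] → [0, 1]`. Continuity at `⊤` says that `ψ t → 0` as
`t → ∞`. -/
structure IsGenerator (ψ : ℝ≥0∞ → ℝ) : Prop where
  mem_Icc : ∀ t, ψ t ∈ Icc (0 : ℝ) 1
  continuous : Continuous ψ
  antitone : Antitone ψ
  map_zero : ψ 0 = 1
  map_top : ψ ⊤ = 0
  strictAntiOn : StrictAntiOn ψ (Icc 0 (sInf {t | ψ t = 0}))

/-- Completely monotonic generators, the class `Ψ_{+∞}`. -/
def IsCMGenerator (ψ : ℝ≥0∞ → ℝ) : Prop :=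
  IsGenerator ψ ∧ CompletelyMonotonic (fun t => ψ (ENNReal.ofReal t))

/-- The generalized inverse `ψ⁻ : [0, 1] → [0, ∞]`. -/
def genInv (ψ : ℝ≥0∞ → ℝ) (s : ℝ) : ℝ≥0∞ := sInf {t | ψ t = s}

/-- `C_ψ(x_S) = ψ (∑_{i ∈ S} ψ⁻ (x_i))`. -/
def archCopula {ι : Type*} (ψ : ℝ≥0∞ → ℝ) (S : Finset ι) (x : ι → ℝ) : ℝ :=
  ψ (∑ i ∈ S, genInv ψ (x i))

/-- The sufficient nesting condition for a parent generator `ψ₁` and a child generator `ψ₂`: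
both are completely monotonic and `(ψ₁⁻¹ ∘ ψ₂)'` is completely monotonic. -/
def Nestable (ψ₁ ψ₂ : ℝ≥0∞ → ℝ) : Prop :=
  IsCMGenerator ψ₁ ∧ IsCMGenerator ψ₂ ∧
    DifferentiableOn ℝ (fun t : ℝ => (genInv ψ₁ (ψ₂ (ENNReal.ofReal t))).toReal) (Ioi 0) ∧
    CompletelyMonotonic
      (deriv (fun t : ℝ => (genInv ψ₁ (ψ₂ (ENNReal.ofReal t))).toReal))

/-! ### The six parametric families -/

/-- The family labels A (Ali-Mikhail-Haq), C (Clayton), 12, 14, 19, 20. -/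
inductive Label : Type
  | A | C | n12 | n14 | n19 | n20

/-- The parameter ranges `Θ_a`. -/
def paramRange : Label → Set ℝ
  | .A => Ico 0 1
  | .C => Ioi 0
  | .n12 => Ici 1
  | .n14 => Ici 1
  | .n19 => Ioi 0
  | .n20 => Ioi 0

/-- The explicit forms of `ψ^{(a,θ)}(t)` for real `t ≥ 0`. -/
def psiReal : Label → ℝ → ℝ → ℝ
  | .A, θ, t => (1 - θ) / (Real.exp t - θ)
  | .C, θ, t => (1 + t) ^ (-1 / θ)
  | .n12, θ, t => (1 + t ^ (1 / θ))⁻¹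
  | .n14, θ, t => (1 + t ^ (1 / θ)) ^ (-θ)
  | .n19, θ, t => θ / Real.log (t + Real.exp θ)
  | .n20, θ, t => (Real.log (t + Real.exp 1)) ^ (-1 / θ)

/-- `ψ^{(a,θ)} : [0, ∞] → [0, 1]`, with the value `0` at `∞`. -/
def psi (a : Label) (θ : ℝ) (t : ℝ≥0∞) : ℝ :=
  if t = ⊤ then 0 else psiReal a θ t.toReal

/-- `FNest a₁ a₂`: the combination (parent family `a₁`, child family `a₂`) is one of the
considered family combinations. -/
inductive FNest : Label → Label → Prop
  | AA : FNest .A .A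
  | CC : FNest .C .C
  | n12n12 : FNest .n12 .n12
  | n19n19 : FNest .n19 .n19
  | n20n20 : FNest .n20 .n20
  | AC : FNest .A .C
  | An19 : FNest .A .n19
  | An20 : FNest .A .n20
  | Cn12 : FNest .C .n12
  | Cn14 : FNest .C .n14
  | Cn19 : FNest .C .n19
  | Cn20 : FNest .C .n20

/-! ### The nesting semigroup -/

/-- The intervals with endpoints `0 ≤ α ≤ β ≤ ∞`, as sets of real numbers. -/
def IsRange (r : Set ℝ) : Prop :=
  ∃ α : ℝ, 0 ≤ α ∧
    ((∃ β : ℝ, α ≤ β ∧ (r = Icc α β ∨ r = Ioc α β ∨ r = Ico α β ∨ r = Ioo α β)) ∨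
      r = Ici α ∨ r = Ioi α)

/-- Finite sets of pairs (family label, parameter range). -/
abbrev NRepr : Type := Finset (Label × Set ℝ)

/-- `N ∈ F_ℝ`: all labels are in `F` and all ranges are intervals of the above kind. -/
def InSemigroup (F : Finset Label) (N : NRepr) : Prop :=
  ∀ p ∈ N, p.1 ∈ F ∧ IsRange p.2

/-- The operation `∩̃`. -/
def tInter (N₁ N₂ : NRepr) : NRepr :=
  ((N₁ ×ˢ N₂).filter (fun p => p.1.1 = p.2.1)).image (fun p => (p.1.1, p.1.2 ∩ p.2.2))

/-- The relation `(a, θ) ∈̃ N`. -/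
def TMem (a : Label) (θ : ℝ) (N : NRepr) : Prop :=
  ∃ r : Set ℝ, (a, r) ∈ N ∧ θ ∈ r

/-- `N` is Archimedean: every represented `ψ^{(a,θ)}` is (defined and) a c.m. generator. -/
def IsArchimedean (N : NRepr) : Prop :=
  ∀ a θ, TMem a θ N → θ ∈ paramRange a ∧ IsCMGenerator (psi a θ)

/-- `N` is `F`-Archimedean: it is an Archimedean element of the semigroup that represents
everything that any Archimedean element represents. -/
def IsFArchimedean (F : Finset Label) (N : NRepr) : Prop :=
  InSemigroup F N ∧ IsArchimedean N ∧
    ∀ N' : NRepr, InSemigroup F N' → IsArchimedean N' → ∀ a θ, TMem a θ N' → TMem a θ N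

/-- `N2` is the mapping `N²_F` for the `F`-Archimedean element `NF`: for each child
`(a₂, θ₂) ∈̃ NF` the value `N2 a₂ θ₂` is an element of the nesting semigroup and represents
exactly the pairs `(a₁, θ₁) ∈̃ NF` such that `(a₁, a₂)` is a considered family combination and
`(ψ^{(a₁,θ₁)}, ψ^{(a₂,θ₂)})` satisfies the sufficient nesting condition. This determines the
value up to the choice of the intervals that represent it. -/
def IsParentMap (F : Finset Label) (NF : NRepr) (N2 : Label → ℝ → NRepr) : Prop :=
  ∀ a₂ θ₂, TMem a₂ θ₂ NF →
    InSemigroup F (N2 a₂ θ₂) ∧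
    ∀ a₁ θ₁, TMem a₁ θ₁ (N2 a₂ θ₂) ↔
      TMem a₁ θ₁ NF ∧ FNest a₁ a₂ ∧ Nestable (psi a₁ θ₁) (psi a₂ θ₂)

/-! ### Conventions of the computing system -/

/-- What the algorithms leave to the implementation: the value used when the inversion of
Kendall's tau has no solution, the breaking of ties in `argmax` and `argmin`, and the
(attained) end points by which an open end of a nonempty interval is replaced. -/
structure Conventions where
  /-- the parameter used for the family `a` when `τ_{(a)}(θ) = τ` has no solution -/
  fallback : Label → ℝ → ℝ
  /-- choice among several maximizing pairs of nodes -/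
  pickPair : Finset (ℕ × ℕ) → ℕ × ℕ
  pickPair_mem : ∀ s : Finset (ℕ × ℕ), s.Nonempty → pickPair s ∈ s
  /-- choice among several best fitting generators -/
  pickFit : Finset (Label × ℝ) → Label × ℝ
  pickFit_mem : ∀ s : Finset (Label × ℝ), s.Nonempty → pickFit s ∈ s
  /-- the left end of the closed interval that replaces `r` -/
  lower : Set ℝ → ℝ
  /-- the right end of the closed interval that replaces a bounded `r` -/
  upper : Set ℝ → ℝ
  lower_mem : ∀ r, IsRange r → r.Nonempty → lower r ∈ r
  lower_eq : ∀ r x, IsRange r → IsLeast r x → lower r = x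
  upper_mem : ∀ r, IsRange r → r.Nonempty → BddAbove r → upper r ∈ r
  upper_eq : ∀ r x, IsRange r → IsGreatest r x → upper r = x
  lower_le_upper : ∀ r, IsRange r → r.Nonempty → BddAbove r → lower r ≤ upper r

/-- `trim(θ, r) = max {min {θ, β}, α}`, where `[α, β]` replaces `r` and `min {θ, ∞} = θ`. -/
def trim (cv : Conventions) (θ : ℝ) (r : Set ℝ) : ℝ :=
  max (if BddAbove r then min θ (cv.upper r) else θ) (cv.lower r)

/-! ### Kendall's tau and its inversion -/

/-- `τ_{(a)}(θ) = 1 - 4 ∫_0^∞ t (ψ'(t))² dt` for `ψ = ψ^{(a,θ)}`. -/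
def kendallTau (a : Label) (θ : ℝ) : ℝ :=
  1 - 4 * ∫ t in Ioi (0 : ℝ), t * (deriv (fun s : ℝ => psi a θ (ENNReal.ofReal s)) t) ^ 2

/-- The estimate `τ_{(a)}⁻¹(τ)`, or the prescribed value if there is no solution. -/
def tauInv (cv : Conventions) (a : Label) (τ : ℝ) : ℝ :=
  if h : ∃ θ, θ ∈ paramRange a ∧ kendallTau a θ = τ then h.choose else cv.fallback a τ

/-- The sample version of Kendall's tau of the columns `i` and `j`. -/
def sampleTau {n d : ℕ} (U : Fin n → Fin d → ℝ) (i j : Fin d) : ℝ :=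
  4 / ((n : ℝ) * ((n : ℝ) - 1)) *
    ∑ k : Fin n, ∑ l : Fin n,
      (if k < l ∧ 0 < (U k i - U l i) * (U k j - U l j) then (1 : ℝ) else 0) - 1

/-- The average of `τⁿ_{ij}` over `I × J`. -/
def avgTau {n d : ℕ} (U : Fin n → Fin d → ℝ) (I J : Finset (Fin d)) : ℝ :=
  (∑ i ∈ I, ∑ j ∈ J, sampleTau U i j) / ((I.card : ℝ) * (J.card : ℝ))

/-! ### Structure estimation

Nodes are numbered from `0`: the leaves are `0, …, d - 1`, the fork created in the loop
`k = 0, …, d - 2` is `d + k`, and the root is `2 d - 2`. -/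

/-- The variables of the structure estimation algorithm. -/
structure StructState (d : ℕ) where
  /-- the nodes that are still to be joined -/
  active : Finset ℕ
  /-- the descendant leaves of a node -/
  leaves : ℕ → Finset (Fin d)
  /-- the two nodes joined by a fork -/
  joined : ℕ → ℕ × ℕ
  /-- the estimate of Kendall's tau of a fork -/
  tau : ℕ → ℝ

/-- Start: all leaves are active. -/
def structInit (d : ℕ) : StructState d where
  active := Finset.range d
  leaves := fun v => Finset.univ.filter (fun w : Fin d => (w : ℕ) = v)
  joined := fun _ => (0, 0)
  tau := fun _ => 0

/-- The pairs `i < j` of active nodes with the largest average Kendall's tau. -/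
def bestPairs {n d : ℕ} (U : Fin n → Fin d → ℝ) (s : StructState d) : Finset (ℕ × ℕ) :=
  ((s.active ×ˢ s.active).filter (fun p => p.1 < p.2)).filter (fun p =>
    ∀ q ∈ (s.active ×ˢ s.active).filter (fun q => q.1 < q.2),
      avgTau U (s.leaves q.1) (s.leaves q.2) ≤ avgTau U (s.leaves p.1) (s.leaves p.2))

/-- One loop: join the chosen pair into the fork `d + k`. -/
def structStep {n d : ℕ} (cv : Conventions) (U : Fin n → Fin d → ℝ) (k : ℕ)
    (s : StructState d) : StructState d :=
  let p := cv.pickPair (bestPairs U s)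
  { active := insert (d + k) (s.active \ {p.1, p.2})
    leaves := Function.update s.leaves (d + k) (s.leaves p.1 ∪ s.leaves p.2)
    joined := Function.update s.joined (d + k) p
    tau := Function.update s.tau (d + k) (avgTau U (s.leaves p.1) (s.leaves p.2)) }

/-- The first `m` loops. -/
def structLoop {n d : ℕ} (cv : Conventions) (U : Fin n → Fin d → ℝ) : ℕ → StructState d
  | 0 => structInit d
  | m + 1 => structStep cv U m (structLoop cv U m)

/-- The structure estimation algorithm: `d - 1` loops. -/
def structEstimate {n d : ℕ} (cv : Conventions) (U : Fin n → Fin d → ℝ) : StructState d :=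
  structLoop cv U (d - 1)

/-! ### The aggregated goodness-of-fit statistic -/

/-- `[0, ∞)`-aggregation functions: idempotent and exchangeable, for every number of
arguments. -/
structure Aggregation where
  toFun : ∀ k : ℕ, (Fin k → ℝ≥0) → ℝ≥0
  idem : ∀ k : ℕ, 1 ≤ k → ∀ x : ℝ≥0, toFun k (fun _ => x) = x
  exch : ∀ (k : ℕ) (σ : Equiv.Perm (Fin k)) (x : Fin k → ℝ≥0), toFun k (x ∘ σ) = toFun k x

/-- A goodness-of-fit statistic for two columns of data and a bivariate copula. -/
abbrev GoF (n : ℕ) : Type := (Fin n → ℝ) → (Fin n → ℝ) → ((Fin 2 → ℝ) → ℝ) → ℝ≥0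

/-- `S_n^g(u_{IJ}, ψ)`: the values of the statistic for the pairs in `I × J`, aggregated by `g`.
(The order of the pairs is irrelevant as `g` is exchangeable, and for a single pair this is the
value of the statistic itself as `g` is idempotent.) -/
def aggStat {n d : ℕ} (U : Fin n → Fin d → ℝ) (g : Aggregation) (S : GoF n)
    (I J : Finset (Fin d)) (ψ : ℝ≥0∞ → ℝ) : ℝ≥0 :=
  g.toFun (I ×ˢ J).card (fun m =>
    let p : Fin d × Fin d := ((I ×ˢ J).equivFin.symm m : Fin d × Fin d)
    S (fun r => U r p.1) (fun r => U r p.2) (archCopula ψ Finset.univ))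

/-! ### The heterogeneous estimation -/

/-- The variables of the heterogeneous estimation: the admissible parents `N¹` of a node, and
the family and the parameter that were estimated for a fork. -/
structure HetState where
  N1 : ℕ → NRepr
  par : ℕ → Label × ℝ

/-- Start: `N¹(v) = N₀` for every leaf `v`. -/
def hetInit (N0 : NRepr) : HetState where
  N1 := fun _ => N0
  par := fun _ => (.A, 0)

/-- The pairs `(a_l, r_l)` of `N` that represent at least one generator. -/
def live (N : NRepr) : NRepr := N.filter (fun p => p.2.Nonempty)

/-- The pairs `(a_l, θ_l)`, where `θ_l` is the inverted Kendall's tau trimmed to `r_l`. -/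
def candidates (cv : Conventions) (τ : ℝ) (N : NRepr) : Finset (Label × ℝ) :=
  (live N).image (fun p => (p.1, trim cv (tauInv cv p.1 τ) p.2))

/-- The candidates with the smallest aggregated statistic. -/
def bestFits {n d : ℕ} (cv : Conventions) (U : Fin n → Fin d → ℝ) (g : Aggregation) (S : GoF n)
    (I J : Finset (Fin d)) (τ : ℝ) (N : NRepr) : Finset (Label × ℝ) :=
  (candidates cv τ N).filter (fun p => ∀ q ∈ candidates cv τ N,
    aggStat U g S I J (psi p.1 p.2) ≤ aggStat U g S I J (psi q.1 q.2))

/-- One loop of the heterogeneous estimation, for the fork `d + k`; `none` means that the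
algorithm stops without a result. -/
def hetStep {n d : ℕ} (cv : Conventions) (U : Fin n → Fin d → ℝ) (N2 : Label → ℝ → NRepr)
    (g : Aggregation) (S : GoF n) (T : StructState d) (k : ℕ) (s : HetState) :
    Option HetState :=
  let i := (T.joined (d + k)).1
  let j := (T.joined (d + k)).2
  let N := tInter (s.N1 i) (s.N1 j)
  if live N = ∅ then none
  else
    let p := cv.pickFit (bestFits cv U g S (T.leaves i) (T.leaves j) (T.tau (d + k)) N)
    let N' := tInter N (N2 p.1 p.2)
    if live N' = ∅ then none
    else some { N1 := Function.update s.N1 (d + k) N'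
                par := Function.update s.par (d + k) p }

/-- The first `m` loops. -/
def hetLoop {n d : ℕ} (cv : Conventions) (U : Fin n → Fin d → ℝ) (N0 : NRepr)
    (N2 : Label → ℝ → NRepr) (g : Aggregation) (S : GoF n) (T : StructState d) :
    ℕ → Option HetState
  | 0 => some (hetInit N0)
  | m + 1 => (hetLoop cv U N0 N2 g S T m).bind (hetStep cv U N2 g S T m)

/-- A set of edges, written as pairs (parent, child), and a labeling of nodes by functions
`[0, ∞] → ℝ`. -/
structure LabelledTree where
  edges : Finset (ℕ × ℕ)
  lam : ℕ → ℝ≥0∞ → ℝ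

/-- The heterogeneous estimation algorithm; `none` means that it stops without a result. -/
def hetEstimate {n d : ℕ} (cv : Conventions) (U : Fin n → Fin d → ℝ) (N0 : NRepr)
    (N2 : Label → ℝ → NRepr) (g : Aggregation) (S : GoF n) : Option LabelledTree :=
  let T := structEstimate cv U
  (hetLoop cv U N0 N2 g S T (d - 1)).map (fun s =>
    { edges := (Finset.range (d - 1)).biUnion (fun k =>
        {(d + k, (T.joined (d + k)).1), (d + k, (T.joined (d + k)).2)})
      lam := fun v => psi (s.par v).1 (s.par v).2 })

/-! ### Hierarchical Archimedean copulas -/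

/-- The children of a node. -/
def LabelledTree.children (L : LabelledTree) (v : ℕ) : Finset ℕ :=
  (L.edges.filter (fun e => e.1 = v)).image Prod.snd

/-- `L` is a rooted tree with nodes `0, …, d + k - 1` and root `d + k - 1` whose leaves are
`0, …, d - 1`; the remaining nodes (forks) have at least two children each and are labelled
with c.m. generators. -/
structure LabelledTree.IsHACTree (L : LabelledTree) (d k : ℕ) : Prop where
  edge_lt : ∀ e ∈ L.edges, e.1 < d + k ∧ e.2 < d + k
  leaf : ∀ v < d, L.children v = ∅
  fork : ∀ v, d ≤ v → v < d + k → 2 ≤ (L.children v).card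
  root : ∀ v, d + k - 1 ∉ L.children v
  parent : ∀ w < d + k - 1, ∃! v, w ∈ L.children v
  reach : ∀ w < d + k, Relation.ReflTransGen (fun v v' => v' ∈ L.children v) (d + k - 1) w
  lam_cm : ∀ v, d ≤ v → v < d + k → IsCMGenerator (L.lam v)

/-- The sufficient nesting condition for a labelled tree. -/
def LabelledTree.SNC (L : LabelledTree) (d k : ℕ) : Prop :=
  ∀ v, d ≤ v → v < d + k → ∀ w ∈ L.children v, d ≤ w → w < d + k →
    Nestable (L.lam v) (L.lam w)

/-- `y` is the value at the root of an assignment `x` of numbers in `[0, 1]` to the nodes that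
equals `u` on the leaves and equals `C_{λ(v)}` of the values at the children at each fork `v`. -/
def LabelledTree.IsValue (L : LabelledTree) (d k : ℕ) (u : Fin d → ℝ) (y : ℝ) : Prop :=
  ∃ x : ℕ → ℝ, (∀ v < d + k, x v ∈ Icc (0 : ℝ) 1) ∧
    (∀ v : Fin d, x v = u v) ∧
    (∀ v, d ≤ v → v < d + k → x v = archCopula (L.lam v) (L.children v) x) ∧
    y = x (d + k - 1)

/-- `d`-copulas: grounded, with uniform margins, `d`-increasing. Only values on the unit cube
matter. -/
structure IsCopula (d : ℕ) (C : (Fin d → ℝ) → ℝ) : Prop where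
  mem_Icc : ∀ u ∈ Icc (0 : Fin d → ℝ) 1, C u ∈ Icc (0 : ℝ) 1
  grounded : ∀ u ∈ Icc (0 : Fin d → ℝ) 1, ∀ i, u i = 0 → C u = 0
  margin : ∀ i, ∀ t ∈ Icc (0 : ℝ) 1, C (Function.update 1 i t) = t
  increasing : ∀ a ∈ Icc (0 : Fin d → ℝ) 1, ∀ b ∈ Icc (0 : Fin d → ℝ) 1, a ≤ b →
    0 ≤ ∑ s : Finset (Fin d), (-1 : ℝ) ^ s.card * C (fun i => if i ∈ s then a i else b i)

/-- `C` is the function `C_{(V,E,λ)}` of the labelled tree on the unit cube. -/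
def LabelledTree.IsHACFunction (L : LabelledTree) (d k : ℕ) (C : (Fin d → ℝ) → ℝ) : Prop :=
  ∀ u ∈ Icc (0 : Fin d → ℝ) 1, ∀ y, L.IsValue d k u y ↔ y = C u

end HAC

end

/-!
The proof has three independent parts.

*The tree.* `ForestInv` records that the state of the structure estimation is a binary forest
rooted at the active nodes, whose leaf sets partition all leaves. After `d - 1` loops a single
active node is left, necessarily the last one.

*No premature stop.* The nesting condition is transitive (`IsStrictGenerator.nestable_trans`),
because `(f ∘ g)' = (f' ∘ g) * g'` and completely monotonic functions are closed under products and
under composition with Bernstein functions. The list of family combinations is transitive up to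
the combinations of A with 12 and 14, and those never matter, since A and 12 (or 14) have no common
parent family (`FNest.trans_of_common_parent`). Therefore the admissible parents of a fork within
`N₀` are exactly the admissible parents of the generator that was chosen for it
(`EstimationInv.fork`), and the hypothesis on two generators suffices for two children. Trimming
stays within a range because the ranges are the order-connected subsets of `[0, ∞)`, a class closed
under intersection.

*The copula.* Margins and groundedness follow by recursion along the tree. That the function is
`d`-increasing is a statement about the vertices of a box, hence about functions on the discrete
cube. `CubeCM` says that such a function has alternating differences, and `CubeCA` that its
increments have. If `f` is completely monotonic (respectively has a completely monotonic
derivative) and `Φ` has the property `CubeCA`, then `f ∘ Φ` has the property `CubeCM`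
(respectively `CubeCA`): see `CubeCA.comp_cm_of_pos`, which inducts on the dimension and needs no
integral representation of completely monotonic functions. The argument of the generator at a fork
is a sum of functions of single coordinates and of Bernstein functions `λ(v)⁻¹ ∘ λ(w)` of the
arguments at its children, so it has the property `CubeCA` by recursion
(`LabelledTree.IsNestedTree.exists_cubeCA`), and at the root the completely monotonic generator
yields the nonnegative alternating sum. Zero coordinates, where the inverse generators are infinite,
are split off beforehand (`LabelledTree.IsNestedTree.isCopula`).
-/

noncomputable section

namespace HAC

/-! ### Calculus of completely monotonic functions -/

/-- Complete monotonicity up to order `n`, in recursive form: `f ≥ 0` on `(0, ∞)`, and for `n + 1`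
also `f` is differentiable there and `-f'` is completely monotonic up to order `n`. -/
def CMUpTo : ℕ → (ℝ → ℝ) → Prop
  | 0, f => ∀ t, 0 < t → 0 ≤ f t
  | n + 1, f => (∀ t, 0 < t → 0 ≤ f t) ∧ DifferentiableOn ℝ f (Ioi 0) ∧
      CMUpTo n (fun t => -deriv f t)

namespace CMUpTo

theorem of_succ {n : ℕ} : ∀ {f : ℝ → ℝ}, CMUpTo (n + 1) f → CMUpTo n f := by
  induction n with
  | zero => intro f hf; exact hf.1
  | succ n ih => intro f hf; exact ⟨hf.1, hf.2.1, ih hf.2.2⟩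

theorem deriv_eq_of_eqOn {f g : ℝ → ℝ} (h : EqOn f g (Ioi 0)) :
    EqOn (deriv f) (deriv g) (Ioi 0) := fun _ ht =>
  (h.eventuallyEq_of_mem (Ioi_mem_nhds ht)).deriv_eq

theorem congr {n : ℕ} : ∀ {f g : ℝ → ℝ}, CMUpTo n f → EqOn f g (Ioi 0) → CMUpTo n g := by
  induction n with
  | zero => intro f g hf h t ht; rw [← h ht]; exact hf t ht
  | succ n ih =>
    intro f g hf h
    refine ⟨fun t ht => ?_, hf.2.1.congr fun t ht => (h ht).symm, ?_⟩
    · rw [← h ht]; exact hf.1 t ht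
    · exact ih hf.2.2 fun t ht => by simp only [deriv_eq_of_eqOn h ht]

theorem add {n : ℕ} : ∀ {f g : ℝ → ℝ}, CMUpTo n f → CMUpTo n g →
    CMUpTo n (fun t => f t + g t) := by
  induction n with
  | zero => intro f g hf hg t ht; exact add_nonneg (hf t ht) (hg t ht)
  | succ n ih =>
    intro f g hf hg
    refine ⟨fun t ht => add_nonneg (hf.1 t ht) (hg.1 t ht), hf.2.1.add hg.2.1, ?_⟩
    refine (ih hf.2.2 hg.2.2).congr fun t ht => ?_
    have h1 := hf.2.1.differentiableAt (Ioi_mem_nhds ht)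
    have h2 := hg.2.1.differentiableAt (Ioi_mem_nhds ht)
    simp only [deriv_fun_add h1 h2]
    ring

theorem mul {n : ℕ} : ∀ {f g : ℝ → ℝ}, CMUpTo n f → CMUpTo n g →
    CMUpTo n (fun t => f t * g t) := by
  induction n with
  | zero => intro f g hf hg t ht; exact mul_nonneg (hf t ht) (hg t ht)
  | succ n ih =>
    intro f g hf hg
    refine ⟨fun t ht => mul_nonneg (hf.1 t ht) (hg.1 t ht), hf.2.1.mul hg.2.1, ?_⟩
    refine ((ih hf.2.2 hg.of_succ).add (ih hf.of_succ hg.2.2)).congr fun t ht => ?_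
    have h1 := hf.2.1.differentiableAt (Ioi_mem_nhds ht)
    have h2 := hg.2.1.differentiableAt (Ioi_mem_nhds ht)
    simp only [deriv_fun_mul h1 h2]
    ring

/-- A completely monotonic function composed with a Bernstein function is completely monotonic. -/
theorem comp {n : ℕ} {g : ℝ → ℝ} (hpos : ∀ t, 0 < t → 0 < g t)
    (hd : DifferentiableOn ℝ g (Ioi 0)) (hg : ∀ n, CMUpTo n (deriv g)) :
    ∀ {f : ℝ → ℝ}, CMUpTo n f → CMUpTo n (fun t => f (g t)) := by
  induction n with
  | zero => intro f hf t ht; exact hf _ (hpos t ht)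
  | succ n ih =>
    intro f hf
    refine ⟨fun t ht => hf.1 _ (hpos t ht), hf.2.1.comp hd fun t ht => hpos t ht, ?_⟩
    refine ((ih hf.2.2).mul (hg n)).congr fun t ht => ?_
    have h1 := (hf.2.1.differentiableAt (Ioi_mem_nhds (hpos t ht))).hasDerivAt
    have h2 := (hd.differentiableAt (Ioi_mem_nhds ht)).hasDerivAt
    have h3 : deriv (fun t => f (g t)) t = deriv f (g t) * deriv g t := (h1.comp t h2).deriv
    simp only [h3]
    ring

theorem contDiffOn {n : ℕ} : ∀ {f : ℝ → ℝ}, CMUpTo n f → CMUpTo (n + 1) f →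
    ContDiffOn ℝ n f (Ioi 0) := by
  induction n with
  | zero =>
    intro f _ hf
    exact contDiffOn_zero.2 hf.2.1.continuousOn
  | succ n ih =>
    intro f hf hf'
    have h : ContDiffOn ℝ n (deriv f) (Ioi 0) := by
      refine (ih hf.2.2 hf'.2.2).neg.congr fun t _ => ?_
      simp
    exact_mod_cast (contDiffOn_succ_iff_deriv_of_isOpen (n := (n : WithTop ℕ∞)) isOpen_Ioi).2
      ⟨hf.2.1, by simp, h⟩

theorem iteratedDeriv_nonneg {n : ℕ} : ∀ {f : ℝ → ℝ}, CMUpTo n f → ∀ t, 0 < t →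
    0 ≤ (-1) ^ n * iteratedDeriv n f t := by
  induction n with
  | zero => intro f hf t ht; simpa using hf t ht
  | succ n ih =>
    intro f hf t ht
    have h := ih hf.2.2 t ht
    rw [iteratedDeriv_succ', pow_succ]
    rw [iteratedDeriv_fun_neg] at h
    linarith

end CMUpTo

namespace CompletelyMonotonic

theorem nonneg {f : ℝ → ℝ} (hf : CompletelyMonotonic f) {t : ℝ} (ht : 0 < t) : 0 ≤ f t := by
  simpa using hf.2 0 t ht

theorem differentiableOn {f : ℝ → ℝ} (hf : CompletelyMonotonic f) :
    DifferentiableOn ℝ f (Ioi 0) :=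
  hf.1.differentiableOn (by simp)

theorem neg_deriv {f : ℝ → ℝ} (hf : CompletelyMonotonic f) :
    CompletelyMonotonic (fun t => -deriv f t) := by
  refine ⟨((contDiffOn_infty_iff_deriv_of_isOpen isOpen_Ioi).1 hf.1).2.neg, fun k t ht => ?_⟩
  have h := hf.2 (k + 1) t ht
  rw [iteratedDeriv_succ', pow_succ] at h
  rw [iteratedDeriv_fun_neg]
  linarith

theorem cmUpTo (n : ℕ) : ∀ {f : ℝ → ℝ}, CompletelyMonotonic f → CMUpTo n f := by
  induction n with
  | zero => intro f hf t ht; exact hf.nonneg ht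
  | succ n ih =>
    intro f hf
    exact ⟨fun t ht => hf.nonneg ht, hf.differentiableOn, ih hf.neg_deriv⟩

theorem of_cmUpTo {f : ℝ → ℝ} (hf : ∀ n, CMUpTo n f) : CompletelyMonotonic f :=
  ⟨contDiffOn_infty.2 fun n => (hf n).contDiffOn (hf (n + 1)),
    fun k => (hf k).iteratedDeriv_nonneg⟩

end CompletelyMonotonic

/-! ### Alternating functions on the discrete cube -/

section Cube

variable {ι : Type*}

/-- The function `Φ` on the discrete cube (the finite subsets of `ι`) has alternating differences
in the coordinates `l`: for all `A ⊆ l` and after fixing all coordinates outside `A` in any way, the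
sum of `(-1) ^ |T| * Φ T` over `T ⊆ A` is nonnegative. In recursive form: both faces `Φ₀`, `Φ₁` in
the direction of the first coordinate and the difference `Φ₀ - Φ₁` have this property for the
other coordinates of `l`. -/
def CubeCM : List ι → (Finset ι → ℝ) → Prop
  | [], Φ => ∀ S, 0 ≤ Φ S
  | i :: l, Φ => CubeCM l (fun S => Φ (S.erase i)) ∧ CubeCM l (fun S => Φ (insert i S)) ∧
      CubeCM l (fun S => Φ (S.erase i) - Φ (insert i S))

/-- The companion of `CubeCM` for functions such as Bernstein functions of sums: there is no
condition on the sign of `Φ`, but all increments `Φ₁ - Φ₀` have alternating differences. -/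
def CubeCA : List ι → (Finset ι → ℝ) → Prop
  | [], _ => True
  | i :: l, Φ => CubeCA l (fun S => Φ (S.erase i)) ∧ CubeCA l (fun S => Φ (insert i S)) ∧
      CubeCM l (fun S => Φ (insert i S) - Φ (S.erase i))

namespace CubeCM

theorem add {l : List ι} : ∀ {Φ Ψ : Finset ι → ℝ}, CubeCM l Φ → CubeCM l Ψ →
    CubeCM l (fun S => Φ S + Ψ S) := by
  induction l with
  | nil => intro Φ Ψ h1 h2 S; exact add_nonneg (h1 S) (h2 S)
  | cons i l ih =>
    intro Φ Ψ h1 h2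
    refine ⟨ih h1.1 h2.1, ih h1.2.1 h2.2.1, ?_⟩
    convert ih h1.2.2 h2.2.2 using 2
    ring

theorem mul {l : List ι} : ∀ {Φ Ψ : Finset ι → ℝ}, CubeCM l Φ → CubeCM l Ψ →
    CubeCM l (fun S => Φ S * Ψ S) := by
  induction l with
  | nil => intro Φ Ψ h1 h2 S; exact mul_nonneg (h1 S) (h2 S)
  | cons i l ih =>
    intro Φ Ψ h1 h2
    refine ⟨ih h1.1 h2.1, ih h1.2.1 h2.2.1, ?_⟩
    convert (ih h1.2.2 h2.1).add (ih h1.2.1 h2.2.2) using 2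
    ring

theorem const {l : List ι} : ∀ {c : ℝ}, 0 ≤ c → CubeCM l (fun _ => c) := by
  induction l with
  | nil => intro c hc S; exact hc
  | cons i l ih =>
    intro c hc
    refine ⟨ih hc, ih hc, ?_⟩
    simpa using ih le_rfl

theorem of_tendsto {l : List ι} : ∀ {Φ : ℝ → Finset ι → ℝ} {Ψ : Finset ι → ℝ},
    (∀ ε, 0 < ε → CubeCM l (Φ ε)) →
    (∀ S, Filter.Tendsto (fun ε => Φ ε S) (nhdsWithin 0 (Ioi 0)) (nhds (Ψ S))) →
    CubeCM l Ψ := by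
  induction l with
  | nil =>
    intro Φ Ψ h ht S
    refine ge_of_tendsto (ht S) ?_
    filter_upwards [self_mem_nhdsWithin] with ε hε using h ε hε S
  | cons i l ih =>
    intro Φ Ψ h ht
    exact ⟨ih (fun ε hε => (h ε hε).1) fun S => ht _,
      ih (fun ε hε => (h ε hε).2.1) fun S => ht _,
      ih (fun ε hε => (h ε hε).2.2) fun S => (ht _).sub (ht _)⟩

/-- If a path of functions on the cube has a velocity with alternating differences, so has its
total increment: every alternating sum is monotone along the path. -/
theorem sub_of_hasDerivAt {l : List ι} : ∀ {F F' : ℝ → Finset ι → ℝ},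
    (∀ S, ∀ t ∈ Icc (0 : ℝ) 1, HasDerivAt (fun t => F t S) (F' t S) t) →
    (∀ t ∈ Icc (0 : ℝ) 1, CubeCM l (F' t)) → CubeCM l (fun S => F 1 S - F 0 S) := by
  induction l with
  | nil =>
    intro F F' hd h S
    have hm : MonotoneOn (fun t => F t S) (Icc (0 : ℝ) 1) := by
      refine monotoneOn_of_deriv_nonneg (convex_Icc 0 1)
        (fun t ht => (hd S t ht).continuousAt.continuousWithinAt)
        (fun t ht => (hd S t (interior_subset ht)).differentiableAt.differentiableWithinAt)
        fun t ht => ?_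
      rw [(hd S t (interior_subset ht)).deriv]
      exact h t (interior_subset ht) S
    have := hm (left_mem_Icc.2 zero_le_one) (right_mem_Icc.2 zero_le_one) zero_le_one
    simpa using this
  | cons i l ih =>
    intro F F' hd h
    refine ⟨ih (F := fun t S => F t (S.erase i)) (fun S => hd _) fun t ht => (h t ht).1,
      ih (F := fun t S => F t (insert i S)) (fun S => hd _) fun t ht => (h t ht).2.1, ?_⟩
    convert ih (F := fun t S => F t (S.erase i) - F t (insert i S))
      (fun S t ht => (hd (S.erase i) t ht).sub (hd (insert i S) t ht))
      (fun t ht => (h t ht).2.2) using 2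
    ring

theorem sum_powerset_nonneg {l : List ι} : ∀ {Φ : Finset ι → ℝ}, l.Nodup → CubeCM l Φ →
    0 ≤ ∑ T ∈ l.toFinset.powerset, (-1 : ℝ) ^ T.card * Φ T := by
  induction l with
  | nil => intro Φ _ h; simpa using h ∅
  | cons i l ih =>
    intro Φ hl h
    obtain ⟨hi, hl⟩ := List.nodup_cons.1 hl
    have hi' : i ∉ l.toFinset := by simpa using hi
    refine (ih hl h.2.2).trans_eq ?_
    rw [List.toFinset_cons, Finset.sum_powerset_insert hi', ← Finset.sum_add_distrib]
    refine Finset.sum_congr rfl fun T hT => ?_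
    have hiT : i ∉ T := fun hh => hi' (Finset.mem_powerset.1 hT hh)
    rw [Finset.card_insert_of_notMem hiT, Finset.erase_eq_of_notMem hiT, pow_succ]
    ring

end CubeCM

namespace CubeCA

theorem add {l : List ι} : ∀ {Φ Ψ : Finset ι → ℝ}, CubeCA l Φ → CubeCA l Ψ →
    CubeCA l (fun S => Φ S + Ψ S) := by
  induction l with
  | nil => intro Φ Ψ _ _; trivial
  | cons i l ih =>
    intro Φ Ψ h1 h2
    refine ⟨ih h1.1 h2.1, ih h1.2.1 h2.2.1, ?_⟩
    convert h1.2.2.add h2.2.2 using 2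
    ring

theorem const {l : List ι} : ∀ {c : ℝ}, CubeCA l (fun _ => c) := by
  induction l with
  | nil => intro c; trivial
  | cons i l ih =>
    intro c
    exact ⟨ih, ih, by simpa using CubeCM.const (l := l) (le_refl (0 : ℝ))⟩

theorem const_mul {l : List ι} {c : ℝ} (hc : 0 ≤ c) : ∀ {Φ : Finset ι → ℝ}, CubeCA l Φ →
    CubeCA l (fun S => c * Φ S) := by
  induction l with
  | nil => intro Φ _; trivial
  | cons i l ih =>
    intro Φ h
    refine ⟨ih h.1, ih h.2.1, ?_⟩
    convert (CubeCM.const hc).mul h.2.2 using 2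
    ring

theorem sum {κ : Type*} {l : List ι} {s : Finset κ} {Φ : κ → Finset ι → ℝ}
    (h : ∀ k ∈ s, CubeCA l (Φ k)) : CubeCA l (fun S => ∑ k ∈ s, Φ k S) := by
  induction s using Finset.induction_on with
  | empty => simpa using const
  | insert a s ha ih =>
    simp only [Finset.sum_insert ha]
    exact (h a (by simp)).add (ih fun k hk => h k (by simp [hk]))

/-- An increasing function of a single coordinate. -/
theorem coordinate {l : List ι} (j : ι) {p q : ℝ} (hqp : q ≤ p) :
    CubeCA l (fun S => if j ∈ S then p else q) := by
  induction l with
  | nil => trivial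
  | cons i l ih =>
    by_cases hij : j = i
    · subst hij
      simp only [CubeCA, Finset.mem_erase, Finset.mem_insert, ne_eq, not_true_eq_false,
        false_and, if_false, true_or, if_true]
      exact ⟨const, const, CubeCM.const (sub_nonneg.2 hqp)⟩
    · simp only [CubeCA, Finset.mem_erase, Finset.mem_insert, ne_eq, hij, not_false_eq_true,
        true_and, false_or, sub_self]
      exact ⟨ih, ih, CubeCM.const le_rfl⟩

theorem of_tendsto {l : List ι} : ∀ {Φ : ℝ → Finset ι → ℝ} {Ψ : Finset ι → ℝ},
    (∀ ε, 0 < ε → CubeCA l (Φ ε)) →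
    (∀ S, Filter.Tendsto (fun ε => Φ ε S) (nhdsWithin 0 (Ioi 0)) (nhds (Ψ S))) →
    CubeCA l Ψ := by
  induction l with
  | nil => intro Φ Ψ _ _; trivial
  | cons i l ih =>
    intro Φ Ψ h ht
    exact ⟨ih (fun ε hε => (h ε hε).1) fun S => ht _,
      ih (fun ε hε => (h ε hε).2.1) fun S => ht _,
      CubeCM.of_tendsto (fun ε hε => (h ε hε).2.2) fun S => (ht _).sub (ht _)⟩

theorem segment_pos {x y t : ℝ} (hx : 0 < x) (hy : 0 < y) (ht : t ∈ Icc (0 : ℝ) 1) :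
    0 < (1 - t) * x + t * y := by
  rcases ht.1.eq_or_lt with h | h
  · subst h; simpa using hx
  · exact add_pos_of_nonneg_of_pos (mul_nonneg (by linarith [ht.2]) hx.le) (mul_pos h hy)

theorem hasDerivAt_comp_segment {f : ℝ → ℝ} (hf : DifferentiableOn ℝ f (Ioi 0)) {x y t : ℝ}
    (hx : 0 < x) (hy : 0 < y) (ht : t ∈ Icc (0 : ℝ) 1) :
    HasDerivAt (fun t => f ((1 - t) * x + t * y))
      (deriv f ((1 - t) * x + t * y) * (y - x)) t := by
  have h1 := (hf.differentiableAt (Ioi_mem_nhds (segment_pos hx hy ht))).hasDerivAt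
  have h2 : HasDerivAt (fun t : ℝ => (1 - t) * x + t * y) (y - x) t := by
    exact ((((hasDerivAt_id' t).const_sub 1).mul_const x).add
      ((hasDerivAt_id' t).mul_const y)).congr_deriv (by ring)
  exact h1.comp t h2

/-- A completely monotonic function turns alternating increments into alternating differences.
In each direction one differentiates along the segment that joins the two opposite faces: the
velocity is `f'` of a convex combination of the faces times their difference, and `-f'` is
completely monotonic while the dimension has dropped. -/
theorem comp_cm_of_pos {l : List ι} : ∀ {f : ℝ → ℝ} {Φ : Finset ι → ℝ},
    CompletelyMonotonic f → CubeCA l Φ → (∀ S, 0 < Φ S) → CubeCM l (fun S => f (Φ S)) := by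
  induction l with
  | nil => intro f Φ hf _ hpos S; exact hf.nonneg (hpos S)
  | cons i l ih =>
    intro f Φ hf h hpos
    refine ⟨ih hf h.1 fun S => hpos _, ih hf h.2.1 fun S => hpos _, ?_⟩
    have key := CubeCM.sub_of_hasDerivAt (l := l)
      (F := fun t S => -f ((1 - t) * Φ (S.erase i) + t * Φ (insert i S)))
      (F' := fun t S => -deriv f ((1 - t) * Φ (S.erase i) + t * Φ (insert i S)) *
        (Φ (insert i S) - Φ (S.erase i)))
      (fun S t ht => by
        rw [neg_mul]
        exact (hasDerivAt_comp_segment hf.differentiableOn (hpos _) (hpos _) ht).neg)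
      (fun t ht => (ih hf.neg_deriv
        ((h.1.const_mul (sub_nonneg.2 ht.2)).add (h.2.1.const_mul ht.1))
        fun S => segment_pos (hpos _) (hpos _) ht).mul h.2.2)
    convert key using 2
    simp only [sub_self, zero_mul, one_mul, zero_add, sub_zero, add_zero]
    ring

/-- The version of `CubeCA.comp_cm_of_pos` for a function whose derivative is completely
monotonic. -/
theorem comp_bernstein_of_pos {l : List ι} {f : ℝ → ℝ} (hd : DifferentiableOn ℝ f (Ioi 0))
    (hf : CompletelyMonotonic (deriv f)) :
    ∀ {Φ : Finset ι → ℝ}, CubeCA l Φ → (∀ S, 0 < Φ S) → CubeCA l (fun S => f (Φ S)) := by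
  induction l with
  | nil => intro Φ _ _; trivial
  | cons i l ih =>
    intro Φ h hpos
    refine ⟨ih h.1 fun S => hpos _, ih h.2.1 fun S => hpos _, ?_⟩
    have key := CubeCM.sub_of_hasDerivAt (l := l)
      (F := fun t S => f ((1 - t) * Φ (S.erase i) + t * Φ (insert i S)))
      (F' := fun t S => deriv f ((1 - t) * Φ (S.erase i) + t * Φ (insert i S)) *
        (Φ (insert i S) - Φ (S.erase i)))
      (fun S t ht => hasDerivAt_comp_segment hd (hpos _) (hpos _) ht)
      (fun t ht => (comp_cm_of_pos hf
        ((h.1.const_mul (sub_nonneg.2 ht.2)).add (h.2.1.const_mul ht.1))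
        fun S => segment_pos (hpos _) (hpos _) ht).mul h.2.2)
    convert key using 2
    simp

theorem tendsto_comp_add {f : ℝ → ℝ} (hc : ContinuousOn f (Ici 0)) {x : ℝ} (hx : 0 ≤ x) :
    Filter.Tendsto (fun ε => f (ε + x)) (nhdsWithin 0 (Ioi 0)) (nhds (f x)) := by
  refine (hc x hx).tendsto.comp (tendsto_nhdsWithin_iff.2 ⟨?_, ?_⟩)
  · have : Filter.Tendsto (fun ε : ℝ => ε + x) (nhds 0) (nhds (0 + x)) :=
      (continuous_id.add continuous_const).tendsto 0
    rw [zero_add] at this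
    exact this.mono_left nhdsWithin_le_nhds
  · filter_upwards [self_mem_nhdsWithin] with ε hε
    exact add_nonneg (le_of_lt hε) hx

theorem comp_cm {l : List ι} {f : ℝ → ℝ} {Φ : Finset ι → ℝ} (hf : CompletelyMonotonic f)
    (hc : ContinuousOn f (Ici 0)) (h : CubeCA l Φ) (hnn : ∀ S, 0 ≤ Φ S) :
    CubeCM l (fun S => f (Φ S)) :=
  CubeCM.of_tendsto (Φ := fun ε S => f (ε + Φ S))
    (fun _ hε => comp_cm_of_pos hf (const.add h) fun S => add_pos_of_pos_of_nonneg hε (hnn S))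
    fun S => tendsto_comp_add hc (hnn S)

theorem comp_bernstein {l : List ι} {f : ℝ → ℝ} {Φ : Finset ι → ℝ}
    (hd : DifferentiableOn ℝ f (Ioi 0)) (hf : CompletelyMonotonic (deriv f))
    (hc : ContinuousOn f (Ici 0)) (h : CubeCA l Φ) (hnn : ∀ S, 0 ≤ Φ S) :
    CubeCA l (fun S => f (Φ S)) :=
  of_tendsto (Φ := fun ε S => f (ε + Φ S))
    (fun _ hε => comp_bernstein_of_pos hd hf (const.add h)
      fun S => add_pos_of_pos_of_nonneg hε (hnn S))
    fun S => tendsto_comp_add hc (hnn S)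

end CubeCA

end Cube

/-! ### Strict generators -/

/-- Generators without finite zeros. -/
structure IsStrictGenerator (ψ : ℝ≥0∞ → ℝ) : Prop extends IsGenerator ψ where
  pos : ∀ t, t ≠ ⊤ → 0 < ψ t

theorem psi_pos {a : Label} {θ : ℝ} (hθ : θ ∈ paramRange a) {t : ℝ≥0∞} (ht : t ≠ ⊤) :
    0 < psi a θ t := by
  rw [psi, if_neg ht]
  have h0 : 0 ≤ t.toReal := ENNReal.toReal_nonneg
  cases a with
  | A =>
    have h1 : 1 ≤ Real.exp t.toReal := Real.one_le_exp h0
    exact div_pos (sub_pos.2 hθ.2) (by linarith [hθ.2])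
  | C => exact Real.rpow_pos_of_pos (by linarith) _
  | n12 => exact inv_pos.2 (add_pos_of_pos_of_nonneg one_pos (Real.rpow_nonneg h0 _))
  | n14 =>
    exact Real.rpow_pos_of_pos (add_pos_of_pos_of_nonneg one_pos (Real.rpow_nonneg h0 _)) _
  | n19 =>
    have h1 : 1 < Real.exp θ := Real.one_lt_exp_iff.2 hθ
    exact div_pos hθ (Real.log_pos (by linarith))
  | n20 =>
    have h1 : 1 < Real.exp 1 := Real.one_lt_exp_iff.2 one_pos
    exact Real.rpow_pos_of_pos (Real.log_pos (by linarith)) _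

theorem isStrictGenerator_psi {a : Label} {θ : ℝ} (hθ : θ ∈ paramRange a)
    (h : IsCMGenerator (psi a θ)) : IsStrictGenerator (psi a θ) :=
  { h.1 with pos := fun _ ht => psi_pos hθ ht }

namespace IsStrictGenerator

variable {ψ ψ₁ ψ₂ ψ₃ : ℝ≥0∞ → ℝ}

theorem strictAnti (h : IsStrictGenerator ψ) : StrictAnti ψ := by
  have h0 : {t | ψ t = 0} = {⊤} := by
    ext t
    refine ⟨fun ht => by_contra fun hne => (h.pos t hne).ne' ht, ?_⟩
    rintro rfl
    exact h.map_top
  have h1 := h.strictAntiOn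
  rw [h0, sInf_singleton] at h1
  exact fun s t hst => h1 ⟨bot_le, le_top⟩ ⟨bot_le, le_top⟩ hst

theorem genInv_apply (h : IsStrictGenerator ψ) (t : ℝ≥0∞) : genInv ψ (ψ t) = t := by
  have : {s | ψ s = ψ t} = {t} := by
    ext s
    exact h.strictAnti.injective.eq_iff
  rw [genInv, this, sInf_singleton]

theorem apply_genInv (h : IsStrictGenerator ψ) {s : ℝ} (hs : s ∈ Icc (0 : ℝ) 1) :
    ψ (genInv ψ s) = s := by
  obtain ⟨t, rfl⟩ : ∃ t, ψ t = s := by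
    refine mem_range_of_exists_le_of_exists_ge h.continuous ⟨⊤, ?_⟩ ⟨0, ?_⟩
    · rw [h.map_top]; exact hs.1
    · rw [h.map_zero]; exact hs.2
  rw [h.genInv_apply]

theorem genInv_zero (h : IsStrictGenerator ψ) : genInv ψ 0 = ⊤ := by
  rw [← h.map_top, h.genInv_apply]

theorem genInv_one (h : IsStrictGenerator ψ) : genInv ψ 1 = 0 := by
  rw [← h.map_zero, h.genInv_apply]

theorem genInv_ne_top (h : IsStrictGenerator ψ) {s : ℝ} (hs : s ∈ Ioc (0 : ℝ) 1) :
    genInv ψ s ≠ ⊤ := by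
  intro ht
  have := h.apply_genInv (Ioc_subset_Icc_self hs)
  rw [ht, h.map_top] at this
  exact hs.1.ne this

theorem genInv_le_genInv (h : IsStrictGenerator ψ) {s t : ℝ} (hs : s ∈ Icc (0 : ℝ) 1)
    (ht : t ∈ Icc (0 : ℝ) 1) (hst : s ≤ t) : genInv ψ t ≤ genInv ψ s := by
  rw [← h.strictAnti.le_iff_ge, h.apply_genInv hs, h.apply_genInv ht]
  exact hst

theorem apply_ofReal_mem (h : IsStrictGenerator ψ) (t : ℝ) :
    ψ (ENNReal.ofReal t) ∈ Ioc (0 : ℝ) 1 :=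
  ⟨h.pos _ ENNReal.ofReal_ne_top, (h.mem_Icc _).2⟩

/-- The function `ψ₁⁻¹ ∘ ψ₂` on `[0, ∞)`. -/
def link (ψ₁ ψ₂ : ℝ≥0∞ → ℝ) (t : ℝ) : ℝ := (genInv ψ₁ (ψ₂ (ENNReal.ofReal t))).toReal

theorem ofReal_link (h₁ : IsStrictGenerator ψ₁) (h₂ : IsStrictGenerator ψ₂) (t : ℝ) :
    ENNReal.ofReal (link ψ₁ ψ₂ t) = genInv ψ₁ (ψ₂ (ENNReal.ofReal t)) :=
  ENNReal.ofReal_toReal (h₁.genInv_ne_top (h₂.apply_ofReal_mem t))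

theorem continuous_link (h₁ : IsStrictGenerator ψ₁) (h₂ : IsStrictGenerator ψ₂) :
    Continuous (link ψ₁ ψ₂) := by
  -- `ψ₁` is an embedding of the compact space `[0, ∞]`
  have hc : Continuous fun t => genInv ψ₁ (ψ₂ t) := by
    rw [(h₁.continuous.isClosedEmbedding h₁.strictAnti.injective).isInducing.continuous_iff]
    refine h₂.continuous.congr fun t => ?_
    exact (h₁.apply_genInv (h₂.mem_Icc t)).symm
  refine continuous_iff_continuousAt.2 fun t => ?_
  exact (ENNReal.continuousAt_toReal (h₁.genInv_ne_top (h₂.apply_ofReal_mem t))).comp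
    (f := fun t => genInv ψ₁ (ψ₂ (ENNReal.ofReal t)))
    (hc.comp ENNReal.continuous_ofReal).continuousAt

theorem link_pos (h₁ : IsStrictGenerator ψ₁) (h₂ : IsStrictGenerator ψ₂) {t : ℝ} (ht : 0 < t) :
    0 < link ψ₁ ψ₂ t := by
  rw [← ENNReal.ofReal_pos, ofReal_link h₁ h₂]
  refine pos_iff_ne_zero.2 fun h0 => ?_
  have h := h₁.apply_genInv (h₂.mem_Icc (ENNReal.ofReal t))
  rw [h0, h₁.map_zero, ← h₂.map_zero] at h
  exact (ENNReal.ofReal_pos.2 ht).ne (h₂.strictAnti.injective h)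

theorem link_comp (h₂ : IsStrictGenerator ψ₂) (h₃ : IsStrictGenerator ψ₃) (t : ℝ) :
    link ψ₁ ψ₂ (link ψ₂ ψ₃ t) = link ψ₁ ψ₃ t := by
  rw [link, ofReal_link h₂ h₃, h₂.apply_genInv (h₃.mem_Icc _), link]

/-- The nesting condition is transitive, because `(f ∘ g)' = (f' ∘ g) * g'` and completely
monotonic functions are closed under products and under composition with Bernstein functions. -/
theorem nestable_trans (h₂ : IsStrictGenerator ψ₂) (h₃ : IsStrictGenerator ψ₃)
    (h12 : Nestable ψ₁ ψ₂) (h23 : Nestable ψ₂ ψ₃) : Nestable ψ₁ ψ₃ := by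
  obtain ⟨hc₁, -, hd12, hm12⟩ := h12
  obtain ⟨-, hc₃, hd23, hm23⟩ := h23
  change DifferentiableOn ℝ (link ψ₁ ψ₂) _ at hd12
  change DifferentiableOn ℝ (link ψ₂ ψ₃) _ at hd23
  have hpos : ∀ t, 0 < t → 0 < link ψ₂ ψ₃ t := fun t => link_pos h₂ h₃
  refine ⟨hc₁, hc₃, ?_, ?_⟩
  · change DifferentiableOn ℝ (link ψ₁ ψ₃) _
    exact (hd12.comp hd23 hpos).congr fun t _ => (link_comp h₂ h₃ t).symm
  · refine CompletelyMonotonic.of_cmUpTo fun n => ?_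
    refine ((CMUpTo.comp hpos hd23 (fun n => hm23.cmUpTo n) (hm12.cmUpTo n)).mul
      (hm23.cmUpTo n)).congr fun t ht => ?_
    have h := (hd12.differentiableAt (Ioi_mem_nhds (hpos t ht))).hasDerivAt.comp t
      (hd23.differentiableAt (Ioi_mem_nhds ht)).hasDerivAt
    rw [show link ψ₁ ψ₂ ∘ link ψ₂ ψ₃ = link ψ₁ ψ₃ from funext (link_comp h₂ h₃)] at h
    exact h.deriv.symm

end IsStrictGenerator

/-! ### The estimated structure -/

/-- The state of the structure estimation after `m` of its loops is a binary forest: its trees are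
rooted at the active nodes, and their leaves form a partition of all leaves. -/
structure ForestInv (d m : ℕ) (s : StructState d) : Prop where
  active_lt : ∀ w ∈ s.active, w < d + m
  card_active : s.active.card + m = d
  parent : ∀ w < d + m, w ∉ s.active → ∃ k < m, w = (s.joined (d + k)).1 ∨ w = (s.joined (d + k)).2
  notMem_active : ∀ k < m, (s.joined (d + k)).1 ∉ s.active ∧ (s.joined (d + k)).2 ∉ s.active
  parent_unique : ∀ w, ∀ k < m, ∀ k' < m,
    (w = (s.joined (d + k)).1 ∨ w = (s.joined (d + k)).2) →
    (w = (s.joined (d + k')).1 ∨ w = (s.joined (d + k')).2) → k = k'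
  joined_lt : ∀ k < m, (s.joined (d + k)).1 < (s.joined (d + k)).2 ∧ (s.joined (d + k)).2 < d + k
  leaves_fork : ∀ k < m, s.leaves (d + k) =
    s.leaves (s.joined (d + k)).1 ∪ s.leaves (s.joined (d + k)).2
  disjoint_fork : ∀ k < m,
    Disjoint (s.leaves (s.joined (d + k)).1) (s.leaves (s.joined (d + k)).2)
  leaves_leaf : ∀ v : Fin d, s.leaves v = {v}
  disjoint_active : ∀ v ∈ s.active, ∀ w ∈ s.active, v ≠ w → Disjoint (s.leaves v) (s.leaves w)
  cover : ∀ i : Fin d, ∃ v ∈ s.active, i ∈ s.leaves v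

theorem bestPairs_nonempty {n d : ℕ} (U : Fin n → Fin d → ℝ) {s : StructState d}
    (h : 1 < s.active.card) : (bestPairs U s).Nonempty := by
  have hne : ((s.active ×ˢ s.active).filter (fun p => p.1 < p.2)).Nonempty := by
    obtain ⟨a, ha, b, hb, hab⟩ := Finset.one_lt_card.1 h
    rcases lt_or_gt_of_ne hab with hlt | hlt
    · exact ⟨(a, b), by simp [ha, hb, hlt]⟩
    · exact ⟨(b, a), by simp [ha, hb, hlt]⟩
  obtain ⟨p, hp, hmax⟩ := Finset.exists_max_image _
    (fun p => avgTau U (s.leaves p.1) (s.leaves p.2)) hne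
  exact ⟨p, Finset.mem_filter.2 ⟨hp, hmax⟩⟩

theorem forestInv_init (d : ℕ) : ForestInv d 0 (structInit d) where
  active_lt := by simp [structInit]
  card_active := by simp [structInit]
  parent := by simp [structInit]
  notMem_active := by simp
  parent_unique := by simp
  joined_lt := by simp
  leaves_fork := by simp
  disjoint_fork := by simp
  leaves_leaf := by
    intro v
    ext w
    simp [structInit, Fin.ext_iff]
  disjoint_active := by
    intro v _ w _ hvw
    rw [Finset.disjoint_left]
    intro x hx hx'
    simp only [structInit, Finset.mem_filter, Finset.mem_univ, true_and] at hx hx'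
    exact hvw (hx.symm.trans hx')
  cover := fun i => ⟨i, by simp [structInit]⟩

theorem forestInv_step {n d : ℕ} (cv : Conventions) (U : Fin n → Fin d → ℝ) {m : ℕ}
    {s : StructState d} (h : ForestInv d m s) (hm : m + 1 < d) :
    ForestInv d (m + 1) (structStep cv U m s) := by
  have hcard := h.card_active
  have hp := cv.pickPair_mem _ (bestPairs_nonempty U (s := s) (by omega))
  set p := cv.pickPair (bestPairs U s) with hpdef
  simp only [bestPairs, Finset.mem_filter, Finset.mem_product] at hp
  obtain ⟨⟨⟨hp1, hp2⟩, hlt⟩, -⟩ := hp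
  have hl1 := h.active_lt _ hp1
  have hl2 := h.active_lt _ hp2
  have hne : p.1 ≠ p.2 := hlt.ne
  have hactive : (structStep cv U m s).active = insert (d + m) (s.active \ {p.1, p.2}) := rfl
  have hleaves : ∀ v, v ≠ d + m → (structStep cv U m s).leaves v = s.leaves v := fun v hv =>
    Function.update_of_ne hv _ _
  have hleaves' : (structStep cv U m s).leaves (d + m) = s.leaves p.1 ∪ s.leaves p.2 :=
    Function.update_self _ _ _
  have hjoined : ∀ k, k ≠ m → (structStep cv U m s).joined (d + k) = s.joined (d + k) :=
    fun k hk => Function.update_of_ne (by omega) _ _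
  have hjoined' : (structStep cv U m s).joined (d + m) = p := Function.update_self _ _ _
  have hmemA : ∀ w, w ∈ (structStep cv U m s).active ↔
      w = d + m ∨ (w ∈ s.active ∧ w ≠ p.1 ∧ w ≠ p.2) := by
    intro w
    rw [hactive]
    simp
  refine ⟨?_, ?_, ?_, ?_, ?_, ?_, ?_, ?_, ?_, ?_, ?_⟩
  · intro w hw
    rcases (hmemA w).1 hw with rfl | hw
    · omega
    · have := h.active_lt w hw.1
      omega
  · rw [hactive, Finset.card_insert_of_notMem, Finset.card_sdiff_of_subset, Finset.card_pair hne]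
    · omega
    · intro x hx
      simp only [Finset.mem_insert, Finset.mem_singleton] at hx
      rcases hx with rfl | rfl <;> assumption
    · intro hmem
      have := h.active_lt _ (Finset.mem_sdiff.1 hmem).1
      omega
  · intro w hw hwA
    rw [hmemA] at hwA
    push Not at hwA
    by_cases hws : w ∈ s.active
    · refine ⟨m, by omega, ?_⟩
      rw [hjoined']
      by_contra hcon
      push Not at hcon
      exact hcon.2 (hwA.2 hws hcon.1)
    · obtain ⟨k, hk, hkw⟩ := h.parent w (by omega) hws
      exact ⟨k, by omega, by rwa [hjoined k (by omega)]⟩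
  · intro k hk
    rw [hmemA, hmemA]
    rcases Nat.lt_succ_iff_lt_or_eq.1 hk with hk | rfl
    · rw [hjoined k (by omega)]
      have h1 := h.notMem_active k hk
      have h2 := h.joined_lt k hk
      constructor
      · rintro (h3 | h3)
        · omega
        · exact h1.1 h3.1
      · rintro (h3 | h3)
        · omega
        · exact h1.2 h3.1
    · rw [hjoined']
      constructor
      · rintro (h3 | h3)
        · omega
        · exact h3.2.1 rfl
      · rintro (h3 | h3)
        · omega
        · exact h3.2.2 rfl
  · intro w k hk k' hk' hw hw'
    have aux : ∀ k < m, (w = (s.joined (d + k)).1 ∨ w = (s.joined (d + k)).2) →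
        (w = p.1 ∨ w = p.2) → False := by
      intro k hk hw hw'
      have h1 := h.notMem_active k hk
      rcases hw with rfl | rfl <;> rcases hw' with e | e <;> rw [e] at h1 <;> tauto
    rcases Nat.lt_succ_iff_lt_or_eq.1 hk with hk | rfl <;>
      rcases Nat.lt_succ_iff_lt_or_eq.1 hk' with hk' | rfl
    · rw [hjoined _ (by omega)] at hw hw'
      exact h.parent_unique w k hk k' hk' hw hw'
    · rw [hjoined k (by omega)] at hw
      rw [hjoined'] at hw'
      exact (aux k hk hw hw').elim
    · rw [hjoined k' (by omega)] at hw'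
      rw [hjoined'] at hw
      exact (aux k' hk' hw' hw).elim
    · rfl
  · intro k hk
    rcases Nat.lt_succ_iff_lt_or_eq.1 hk with hk | rfl
    · rw [hjoined k (by omega)]
      exact h.joined_lt k hk
    · rw [hjoined']
      exact ⟨hlt, hl2⟩
  · intro k hk
    rcases Nat.lt_succ_iff_lt_or_eq.1 hk with hk | rfl
    · have h2 := h.joined_lt k hk
      rw [hjoined k (by omega), hleaves _ (by omega), hleaves _ (by omega), hleaves _ (by omega)]
      exact h.leaves_fork k hk
    · rw [hjoined', hleaves', hleaves _ (by omega), hleaves _ (by omega)]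
  · intro k hk
    rcases Nat.lt_succ_iff_lt_or_eq.1 hk with hk | rfl
    · have h2 := h.joined_lt k hk
      rw [hjoined k (by omega), hleaves _ (by omega), hleaves _ (by omega)]
      exact h.disjoint_fork k hk
    · rw [hjoined', hleaves _ (by omega), hleaves _ (by omega)]
      exact h.disjoint_active _ hp1 _ hp2 hne
  · intro v
    rw [hleaves _ (by omega)]
    exact h.leaves_leaf v
  · have aux : ∀ w ∈ s.active, w ≠ p.1 → w ≠ p.2 →
        Disjoint (s.leaves w) (s.leaves p.1 ∪ s.leaves p.2) := fun w hw h1 h2 =>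
      Finset.disjoint_union_right.2
        ⟨h.disjoint_active _ hw _ hp1 h1, h.disjoint_active _ hw _ hp2 h2⟩
    intro v hv w hw hvw
    rcases (hmemA v).1 hv with rfl | hv <;> rcases (hmemA w).1 hw with rfl | hw
    · exact (hvw rfl).elim
    · rw [hleaves', hleaves w hvw.symm]
      exact (aux w hw.1 hw.2.1 hw.2.2).symm
    · rw [hleaves', hleaves v hvw]
      exact aux v hv.1 hv.2.1 hv.2.2
    · have := h.active_lt v hv.1
      have := h.active_lt w hw.1
      rw [hleaves v (by omega), hleaves w (by omega)]
      exact h.disjoint_active v hv.1 w hw.1 hvw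
  · intro i
    obtain ⟨v, hv, hi⟩ := h.cover i
    by_cases hvp : v = p.1 ∨ v = p.2
    · refine ⟨d + m, (hmemA _).2 (Or.inl rfl), ?_⟩
      rw [hleaves', Finset.mem_union]
      rcases hvp with rfl | rfl
      · exact Or.inl hi
      · exact Or.inr hi
    · push Not at hvp
      have := h.active_lt v hv
      refine ⟨v, (hmemA _).2 (Or.inr ⟨hv, hvp⟩), ?_⟩
      rwa [hleaves v (by omega)]

theorem forestInv_loop {n d : ℕ} (cv : Conventions) (U : Fin n → Fin d → ℝ) :
    ∀ m < d, ForestInv d m (structLoop cv U m)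
  | 0, _ => forestInv_init d
  | m + 1, hm => forestInv_step cv U (forestInv_loop cv U m (by omega)) hm

/-- The final state of the structure estimation describes a binary tree with root
`d + (d - 1) - 1`. -/
theorem forestInv_structEstimate {n d : ℕ} (hd : 0 < d) (cv : Conventions)
    (U : Fin n → Fin d → ℝ) : ForestInv d (d - 1) (structEstimate cv U) :=
  forestInv_loop cv U (d - 1) (by omega)

theorem ForestInv.active_eq {d : ℕ} (hd : 0 < d) {s : StructState d} (h : ForestInv d (d - 1) s) :
    s.active = {d + (d - 1) - 1} := by
  -- the last node is not the child of a fork, as children are smaller than their parent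
  have hmem : d + (d - 1) - 1 ∈ s.active := by
    by_contra hcon
    obtain ⟨k, hk, hw⟩ := h.parent _ (by omega) hcon
    have := h.joined_lt k hk
    omega
  have hcard := h.card_active
  exact (Finset.card_eq_one.1 (by omega : s.active.card = 1)).elim fun x hx => by
    rw [hx] at hmem ⊢
    rw [Finset.mem_singleton.1 hmem]

theorem ForestInv.leaves_root {d : ℕ} (hd : 0 < d) {s : StructState d}
    (h : ForestInv d (d - 1) s) : s.leaves (d + (d - 1) - 1) = Finset.univ := by
  refine Finset.eq_univ_iff_forall.2 fun i => ?_
  obtain ⟨v, hv, hi⟩ := h.cover i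
  rw [h.active_eq hd, Finset.mem_singleton] at hv
  rwa [hv] at hi

/-! ### Representations of sets of generators -/

theorem tMem_tInter {a : Label} {θ : ℝ} {N₁ N₂ : NRepr} :
    TMem a θ (tInter N₁ N₂) ↔ TMem a θ N₁ ∧ TMem a θ N₂ := by
  constructor
  · rintro ⟨r, hr, hθ⟩
    simp only [tInter, Finset.mem_image, Finset.mem_filter, Finset.mem_product] at hr
    obtain ⟨⟨⟨a₁, r₁⟩, ⟨a₂, r₂⟩⟩, ⟨⟨h1, h2⟩, h3⟩, h4⟩ := hr
    simp only [Prod.mk.injEq] at h1 h2 h3 h4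
    obtain ⟨rfl, rfl⟩ := h4
    subst h3
    exact ⟨⟨r₁, h1, hθ.1⟩, ⟨r₂, h2, hθ.2⟩⟩
  · rintro ⟨⟨r₁, h1, hθ₁⟩, ⟨r₂, h2, hθ₂⟩⟩
    refine ⟨r₁ ∩ r₂, ?_, hθ₁, hθ₂⟩
    simp only [tInter, Finset.mem_image, Finset.mem_filter, Finset.mem_product]
    exact ⟨((a, r₁), (a, r₂)), ⟨⟨h1, h2⟩, rfl⟩, rfl⟩

theorem isRange_iff {r : Set ℝ} : IsRange r ↔ r ⊆ Ici 0 ∧ r.OrdConnected := by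
  constructor
  · rintro ⟨α, hα, ⟨β, -, rfl | rfl | rfl | rfl⟩ | rfl | rfl⟩
    · exact ⟨fun x hx => hα.trans hx.1, ordConnected_Icc⟩
    · exact ⟨fun x hx => hα.trans hx.1.le, ordConnected_Ioc⟩
    · exact ⟨fun x hx => hα.trans hx.1, ordConnected_Ico⟩
    · exact ⟨fun x hx => hα.trans hx.1.le, ordConnected_Ioo⟩
    · exact ⟨fun x hx => hα.trans hx, ordConnected_Ici⟩
    · exact ⟨fun x hx => hα.trans (le_of_lt hx), ordConnected_Ioi⟩
  · rintro ⟨h0, hc⟩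
    rcases r.eq_empty_or_nonempty with rfl | hne
    · exact ⟨0, le_rfl, Or.inl ⟨0, le_rfl, by simp⟩⟩
    have hb : BddBelow r := ⟨0, h0⟩
    have hi : 0 ≤ sInf r := le_csInf hne h0
    by_cases ha : BddAbove r
    · have hs : sInf r ≤ sSup r := csInf_le_csSup hne hb ha
      refine ⟨sInf r, hi, Or.inl ⟨sSup r, hs, ?_⟩⟩
      rcases hc.isPreconnected.mem_intervals with h | h | h | h | h | h | h | h | h | h
      · exact Or.inl h
      · exact Or.inr (Or.inr (Or.inl h))
      · exact Or.inr (Or.inl h)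
      · exact Or.inr (Or.inr (Or.inr h))
      · rw [h] at ha; exact (not_bddAbove_Ici _ ha).elim
      · rw [h] at ha; exact (not_bddAbove_Ioi _ ha).elim
      · rw [h] at hb; exact (not_bddBelow_Iic _ hb).elim
      · rw [h] at hb; exact (not_bddBelow_Iio _ hb).elim
      · rw [h] at ha; exact (not_bddAbove_univ ha).elim
      · exact (hne.ne_empty h).elim
    · refine ⟨sInf r, hi, Or.inr ?_⟩
      rcases hc.isPreconnected.mem_intervals with h | h | h | h | h | h | h | h | h | h
      · rw [h] at ha; exact (ha bddAbove_Icc).elim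
      · rw [h] at ha; exact (ha bddAbove_Ico).elim
      · rw [h] at ha; exact (ha bddAbove_Ioc).elim
      · rw [h] at ha; exact (ha bddAbove_Ioo).elim
      · exact Or.inl h
      · exact Or.inr h
      · rw [h] at hb; exact (not_bddBelow_Iic _ hb).elim
      · rw [h] at hb; exact (not_bddBelow_Iio _ hb).elim
      · rw [h] at hb; exact (not_bddBelow_univ hb).elim
      · exact (hne.ne_empty h).elim

theorem inSemigroup_tInter {F : Finset Label} {N₁ N₂ : NRepr} (h₁ : InSemigroup F N₁)
    (h₂ : InSemigroup F N₂) : InSemigroup F (tInter N₁ N₂) := by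
  intro p hp
  simp only [tInter, Finset.mem_image, Finset.mem_filter, Finset.mem_product] at hp
  obtain ⟨q, ⟨⟨hq1, hq2⟩, -⟩, rfl⟩ := hp
  have h1 := isRange_iff.1 (h₁ _ hq1).2
  have h2 := isRange_iff.1 (h₂ _ hq2).2
  exact ⟨(h₁ _ hq1).1, isRange_iff.2 ⟨inter_subset_left.trans h1.1, h1.2.inter h2.2⟩⟩

theorem live_nonempty {a : Label} {θ : ℝ} {N : NRepr} (h : TMem a θ N) : (live N).Nonempty := by
  obtain ⟨r, hr, hθ⟩ := h
  exact ⟨(a, r), Finset.mem_filter.2 ⟨hr, θ, hθ⟩⟩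

theorem trim_mem (cv : Conventions) (θ : ℝ) {r : Set ℝ} (hr : IsRange r) (hne : r.Nonempty) :
    trim cv θ r ∈ r := by
  have hl := cv.lower_mem r hr hne
  have hc := (isRange_iff.1 hr).2
  by_cases hb : BddAbove r
  · rw [trim, if_pos hb]
    exact hc.out hl (cv.upper_mem r hr hne hb) ⟨le_max_right _ _,
      max_le (min_le_right _ _) (cv.lower_le_upper r hr hne hb)⟩
  · rw [trim, if_neg hb]
    obtain ⟨x, hx, hlt⟩ := not_bddAbove_iff.1 hb (max θ (cv.lower r))
    exact hc.out hl hx ⟨le_max_right _ _, hlt.le⟩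

theorem tMem_of_mem_candidates {F : Finset Label} {cv : Conventions} {τ : ℝ} {N : NRepr}
    (hN : InSemigroup F N) {p : Label × ℝ} (hp : p ∈ candidates cv τ N) : TMem p.1 p.2 N := by
  simp only [candidates, live, Finset.mem_image, Finset.mem_filter] at hp
  obtain ⟨⟨a, r⟩, ⟨hr, hne⟩, rfl⟩ := hp
  exact ⟨r, hr, trim_mem cv _ (hN _ hr).2 hne⟩

/-- The generator chosen for a fork is represented by the admissible set it is chosen from. -/
theorem tMem_pickFit {F : Finset Label} {n d : ℕ} (cv : Conventions) (U : Fin n → Fin d → ℝ)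
    (g : Aggregation) (S : GoF n) (I J : Finset (Fin d)) (τ : ℝ) {N : NRepr}
    (hN : InSemigroup F N) (hne : ∃ a θ, TMem a θ N) :
    TMem (cv.pickFit (bestFits cv U g S I J τ N)).1 (cv.pickFit (bestFits cv U g S I J τ N)).2
      N := by
  obtain ⟨a, θ, h⟩ := hne
  have hc : (candidates cv τ N).Nonempty := (live_nonempty h).image _
  obtain ⟨p, hp, hmin⟩ := Finset.exists_min_image _
    (fun p => aggStat U g S I J (psi p.1 p.2)) hc
  have hb : (bestFits cv U g S I J τ N).Nonempty := ⟨p, Finset.mem_filter.2 ⟨hp, hmin⟩⟩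
  exact tMem_of_mem_candidates hN (Finset.mem_filter.1 (cv.pickFit_mem _ hb)).1

/-! ### The heterogeneous estimation succeeds -/

/-- The considered family combinations are transitive, except for the missing combinations
`(A, 12)` and `(A, 14)`; these have no common parent. -/
theorem FNest.trans_of_common_parent {a b c e : Label} (hab : FNest a b) (hbc : FNest b c)
    (hea : FNest e a) (hec : FNest e c) : FNest a c := by
  cases hab <;> cases hbc <;> cases hea <;> cases hec <;> constructor

section Estimation

variable {F : Finset Label} {NF : NRepr} {N2 : Label → ℝ → NRepr} {N0 : NRepr}

/-- Every two generators represented by `N0` have a common admissible parent in `N0`. -/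
def HasCommonParents (N2 : Label → ℝ → NRepr) (N0 : NRepr) : Prop :=
  ∀ p q : Label × ℝ, TMem p.1 p.2 N0 → TMem q.1 q.2 N0 →
    ∃ a θ, TMem a θ N0 ∧ TMem a θ (N2 p.1 p.2) ∧ TMem a θ (N2 q.1 q.2)

/-- Admissible parents of admissible parents are admissible, within `N0`. -/
theorem tMem_parent_trans (hN2 : IsParentMap F NF N2) (hNF : IsArchimedean NF)
    (hsub : ∀ a θ, TMem a θ N0 → TMem a θ NF) (hcp : HasCommonParents N2 N0)
    {p q r : Label × ℝ} (hp : TMem p.1 p.2 N0) (hq : TMem q.1 q.2 N0) (hr : TMem r.1 r.2 N0)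
    (hqp : TMem q.1 q.2 (N2 p.1 p.2)) (hrq : TMem r.1 r.2 (N2 q.1 q.2)) :
    TMem r.1 r.2 (N2 p.1 p.2) := by
  have hp' := hNF _ _ (hsub _ _ hp)
  have hq' := hNF _ _ (hsub _ _ hq)
  have hqp' := ((hN2 _ _ (hsub _ _ hp)).2 _ _).1 hqp
  have hrq' := ((hN2 _ _ (hsub _ _ hq)).2 _ _).1 hrq
  obtain ⟨a, θ, -, h1, h2⟩ := hcp r p hr hp
  have h1' := ((hN2 _ _ (hsub _ _ hr)).2 _ _).1 h1
  have h2' := ((hN2 _ _ (hsub _ _ hp)).2 _ _).1 h2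
  refine ((hN2 _ _ (hsub _ _ hp)).2 _ _).2 ⟨hsub _ _ hr,
    hrq'.2.1.trans_of_common_parent hqp'.2.1 h1'.2.1 h2'.2.1, ?_⟩
  exact (isStrictGenerator_psi hq'.1 hq'.2).nestable_trans (isStrictGenerator_psi hp'.1 hp'.2)
    hrq'.2.2 hqp'.2.2

/-- After `m` loops the chosen generators are represented by `N0`, each is an admissible parent of
those chosen for its children, and the admissible parents of a fork in `N0` are just those of the
generator chosen for this fork. -/
structure EstimationInv (F : Finset Label) (N2 : Label → ℝ → NRepr) (N0 : NRepr) (d m : ℕ)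
    (joined : ℕ → ℕ × ℕ) (s : HetState) : Prop where
  inSemigroup : ∀ v, InSemigroup F (s.N1 v)
  leaf : ∀ v < d, s.N1 v = N0
  fork : ∀ k < m, ∀ a θ, TMem a θ (s.N1 (d + k)) ↔
    TMem a θ N0 ∧ TMem a θ (N2 (s.par (d + k)).1 (s.par (d + k)).2)
  par_mem : ∀ k < m, TMem (s.par (d + k)).1 (s.par (d + k)).2 N0
  nested : ∀ k < m, ∀ w, d ≤ w → (w = (joined (d + k)).1 ∨ w = (joined (d + k)).2) →
    TMem (s.par (d + k)).1 (s.par (d + k)).2 (N2 (s.par w).1 (s.par w).2)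

/-- The admissible parents of an arbitrary node. -/
theorem EstimationInv.exists_tMem_iff {d m : ℕ} {joined : ℕ → ℕ × ℕ} {s : HetState}
    (h : EstimationInv F N2 N0 d m joined s) {v : ℕ} (hv : v < d + m) :
    (v < d ∧ ∀ a θ, TMem a θ (s.N1 v) ↔ TMem a θ N0) ∨
    (d ≤ v ∧ TMem (s.par v).1 (s.par v).2 N0 ∧ ∀ a θ, TMem a θ (s.N1 v) ↔
      TMem a θ N0 ∧ TMem a θ (N2 (s.par v).1 (s.par v).2)) := by
  by_cases hvd : v < d
  · exact Or.inl ⟨hvd, fun a θ => by rw [h.leaf v hvd]⟩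
  · obtain ⟨k, rfl⟩ := Nat.exists_eq_add_of_le (not_lt.1 hvd)
    exact Or.inr ⟨by omega, h.par_mem k (by omega), h.fork k (by omega)⟩

theorem estimationInv_step (hN2 : IsParentMap F NF N2) (hNF : IsArchimedean NF)
    (hsub : ∀ a θ, TMem a θ N0 → TMem a θ NF) (hcp : HasCommonParents N2 N0)
    (hne : ∃ a θ, TMem a θ N0) {n d m : ℕ} (cv : Conventions) (U : Fin n → Fin d → ℝ)
    (g : Aggregation) (S : GoF n) (T : StructState d) {s : HetState}
    (h1 : (T.joined (d + m)).1 < d + m) (h2 : (T.joined (d + m)).2 < d + m)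
    (hlt : ∀ k < m, (T.joined (d + k)).1 < d + k ∧ (T.joined (d + k)).2 < d + k)
    (h : EstimationInv F N2 N0 d m T.joined s) :
    ∃ s', hetStep cv U N2 g S T m s = some s' ∧ EstimationInv F N2 N0 d (m + 1) T.joined s' := by
  set i := (T.joined (d + m)).1 with hi
  set j := (T.joined (d + m)).2 with hj
  set N := tInter (s.N1 i) (s.N1 j) with hN
  set p := cv.pickFit (bestFits cv U g S (T.leaves i) (T.leaves j) (T.tau (d + m)) N) with hp
  have hNs : InSemigroup F N := inSemigroup_tInter (h.inSemigroup i) (h.inSemigroup j)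
  have hNne : ∃ a θ, TMem a θ N := by
    simp only [hN, tMem_tInter]
    rcases h.exists_tMem_iff h1 with ⟨-, hi'⟩ | ⟨-, hpi, hi'⟩ <;>
      rcases h.exists_tMem_iff h2 with ⟨-, hj'⟩ | ⟨-, hpj, hj'⟩ <;> simp only [hi', hj']
    · obtain ⟨a, θ, ha⟩ := hne
      exact ⟨a, θ, ha, ha⟩
    · obtain ⟨a, θ, ha, hb, -⟩ := hcp _ _ hpj hpj
      exact ⟨a, θ, ha, ha, hb⟩
    · obtain ⟨a, θ, ha, hb, -⟩ := hcp _ _ hpi hpi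
      exact ⟨a, θ, ⟨ha, hb⟩, ha⟩
    · obtain ⟨a, θ, ha, hb, hc⟩ := hcp _ _ hpi hpj
      exact ⟨a, θ, ⟨ha, hb⟩, ha, hc⟩
  have hpN : TMem p.1 p.2 N := tMem_pickFit cv U g S _ _ _ hNs hNne
  obtain ⟨hpi, hpj⟩ := tMem_tInter.1 hpN
  have hpN0 : TMem p.1 p.2 N0 := by
    rcases h.exists_tMem_iff h1 with ⟨-, hi'⟩ | ⟨-, -, hi'⟩
    · exact (hi' _ _).1 hpi
    · exact ((hi' _ _).1 hpi).1
  -- by transitivity the parents of `p` are admissible for both children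
  have key : ∀ v < d + m, TMem p.1 p.2 (s.N1 v) → ∀ a θ, TMem a θ N0 →
      TMem a θ (N2 p.1 p.2) → TMem a θ (s.N1 v) := by
    intro v hv hpv a θ ha hb
    rcases h.exists_tMem_iff hv with ⟨-, hv'⟩ | ⟨-, hpv', hv'⟩
    · exact (hv' _ _).2 ha
    · exact (hv' _ _).2 ⟨ha, tMem_parent_trans (r := (a, θ)) hN2 hNF hsub hcp hpv' hpN0 ha
        ((hv' _ _).1 hpv).2 hb⟩
  have hN' : ∀ a θ, TMem a θ (tInter N (N2 p.1 p.2)) ↔ TMem a θ N0 ∧ TMem a θ (N2 p.1 p.2) := by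
    intro a θ
    rw [tMem_tInter, hN, tMem_tInter]
    constructor
    · rintro ⟨⟨ha, -⟩, hb⟩
      refine ⟨?_, hb⟩
      rcases h.exists_tMem_iff h1 with ⟨-, hi'⟩ | ⟨-, -, hi'⟩
      · exact (hi' _ _).1 ha
      · exact ((hi' _ _).1 ha).1
    · rintro ⟨ha, hb⟩
      exact ⟨⟨key i h1 hpi a θ ha hb, key j h2 hpj a θ ha hb⟩, hb⟩
  have hlive : live N ≠ ∅ := by
    obtain ⟨a, θ, ha⟩ := hNne
    exact (live_nonempty ha).ne_empty
  have hlive' : live (tInter N (N2 p.1 p.2)) ≠ ∅ := by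
    obtain ⟨a, θ, ha, hb, -⟩ := hcp p p hpN0 hpN0
    exact (live_nonempty ((hN' a θ).2 ⟨ha, hb⟩)).ne_empty
  refine ⟨{ N1 := Function.update s.N1 (d + m) (tInter N (N2 p.1 p.2))
            par := Function.update s.par (d + m) p }, ?_, ?_⟩
  · simp only [hetStep, ← hi, ← hj, ← hN, ← hp, if_neg hlive, if_neg hlive']
  · have hN1 : ∀ v, v ≠ d + m →
        Function.update s.N1 (d + m) (tInter N (N2 p.1 p.2)) v = s.N1 v :=
      fun v hv => Function.update_of_ne hv _ _
    have hpar : ∀ v, v ≠ d + m → Function.update s.par (d + m) p v = s.par v :=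
      fun v hv => Function.update_of_ne hv _ _
    refine ⟨fun v => ?_, fun v hv => ?_, fun k hk => ?_, fun k hk => ?_, fun k hk w hw hwk => ?_⟩
    · by_cases hv : v = d + m
      · subst hv
        simp only [Function.update_self]
        exact inSemigroup_tInter hNs (hN2 _ _ (hsub _ _ hpN0)).1
      · simp only [hN1 v hv]
        exact h.inSemigroup v
    · simp only [hN1 v (by omega)]
      exact h.leaf v hv
    · rcases Nat.lt_succ_iff_lt_or_eq.1 hk with hk | rfl
      · simp only [hN1 (d + k) (by omega), hpar (d + k) (by omega)]
        exact h.fork k hk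
      · simp only [Function.update_self]
        exact hN'
    · rcases Nat.lt_succ_iff_lt_or_eq.1 hk with hk | rfl
      · simp only [hpar (d + k) (by omega)]
        exact h.par_mem k hk
      · simp only [Function.update_self]
        exact hpN0
    · rcases Nat.lt_succ_iff_lt_or_eq.1 hk with hk | rfl
      · have h3 := hlt k hk
        simp only [hpar (d + k) (by omega), hpar w (by omega)]
        exact h.nested k hk w hw hwk
      · have hwlt : w < d + k := by rcases hwk with rfl | rfl <;> assumption
        simp only [Function.update_self, hpar w (by omega)]
        have hpw : TMem p.1 p.2 (s.N1 w) := by rcases hwk with rfl | rfl <;> assumption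
        rcases h.exists_tMem_iff hwlt with ⟨hwd, -⟩ | ⟨-, -, hw'⟩
        · omega
        · exact ((hw' _ _).1 hpw).2

theorem estimationInv_loop (hN2 : IsParentMap F NF N2) (hNF : IsArchimedean NF)
    (hsub : ∀ a θ, TMem a θ N0 → TMem a θ NF) (hcp : HasCommonParents N2 N0)
    (hN0 : InSemigroup F N0) (hne : ∃ a θ, TMem a θ N0) {n d : ℕ} (cv : Conventions)
    (U : Fin n → Fin d → ℝ) (g : Aggregation) (S : GoF n) (T : StructState d) :
    ∀ m, (∀ k < m, (T.joined (d + k)).1 < d + k ∧ (T.joined (d + k)).2 < d + k) →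
      ∃ s, hetLoop cv U N0 N2 g S T m = some s ∧ EstimationInv F N2 N0 d m T.joined s
  | 0, _ => ⟨hetInit N0, rfl, fun _ => hN0, fun _ _ => rfl, by simp, by simp, by simp⟩
  | m + 1, hlt => by
    obtain ⟨s, hs, hinv⟩ := estimationInv_loop hN2 hNF hsub hcp hN0 hne cv U g S T m
      fun k hk => hlt k (by omega)
    obtain ⟨s', hs', hinv'⟩ := estimationInv_step hN2 hNF hsub hcp hne cv U g S T
      (hlt m (by omega)).1 (hlt m (by omega)).2 (fun k hk => hlt k (by omega)) hinv
    exact ⟨s', by rw [hetLoop, hs]; exact hs', hinv'⟩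

end Estimation

/-! ### The copula of a nested tree of strict generators -/

namespace LabelledTree

/-- The value that the node `v` receives when the leaves receive the values `u`. Children are
assumed to have smaller numbers than their parents; a child that has not counts with the
value `0`. -/
def nodeValue (L : LabelledTree) (d : ℕ) (u : Fin d → ℝ) (v : ℕ) : ℝ :=
  if h : v < d then u ⟨v, h⟩
  else archCopula (L.lam v) (L.children v) fun w =>
    if _hw : w < v then nodeValue L d u w else 0
termination_by v

/-- The nodes `0, …, D - 1` of `L` form a tree (or forest) with leaves `0, …, d - 1` in which
children precede their parents, `leaves v` being the set of the leaves below `v`; the forks are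
labelled with strict c.m. generators that satisfy the nesting condition along the edges. -/
structure IsNestedTree (L : LabelledTree) (d D : ℕ) (leaves : ℕ → Finset (Fin d)) : Prop where
  child_lt : ∀ v, ∀ w ∈ L.children v, w < v
  leaves_leaf : ∀ v : Fin d, leaves v = {v}
  mem_leaves : ∀ v, d ≤ v → v < D → ∀ i, i ∈ leaves v ↔ ∃ w ∈ L.children v, i ∈ leaves w
  disjoint : ∀ v, d ≤ v → v < D → ∀ w ∈ L.children v, ∀ w' ∈ L.children v, w ≠ w' →
    Disjoint (leaves w) (leaves w')
  strict : ∀ v, d ≤ v → v < D → IsStrictGenerator (L.lam v)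
  cm : ∀ v, d ≤ v → v < D → IsCMGenerator (L.lam v)
  nested : ∀ v, d ≤ v → v < D → ∀ w ∈ L.children v, d ≤ w → Nestable (L.lam v) (L.lam w)

namespace IsNestedTree

variable {L : LabelledTree} {d D : ℕ} {leaves : ℕ → Finset (Fin d)}

theorem nodeValue_leaf (L : LabelledTree) (u : Fin d → ℝ) (v : Fin d) :
    L.nodeValue d u v = u v := by
  rw [nodeValue, dif_pos v.2]

theorem nodeValue_fork (h : L.IsNestedTree d D leaves) (u : Fin d → ℝ) {v : ℕ} (hv : d ≤ v) :
    L.nodeValue d u v = archCopula (L.lam v) (L.children v) (L.nodeValue d u) := by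
  rw [nodeValue, dif_neg (not_lt.2 hv), archCopula, archCopula]
  congr 1
  refine Finset.sum_congr rfl fun w hw => ?_
  rw [dif_pos (h.child_lt v w hw)]

theorem nodeValue_mem (h : L.IsNestedTree d D leaves) {u : Fin d → ℝ} (hu : u ∈ Icc 0 1) {v : ℕ}
    (hv : v < D) : L.nodeValue d u v ∈ Icc (0 : ℝ) 1 := by
  by_cases hvd : v < d
  · have := nodeValue_leaf L u ⟨v, hvd⟩
    rw [this]
    exact ⟨hu.1 _, hu.2 _⟩
  · rw [h.nodeValue_fork u (not_lt.1 hvd)]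
    exact (h.strict v (not_lt.1 hvd) hv).mem_Icc _

theorem isValue_iff {k : ℕ} (h : L.IsNestedTree d (d + k) leaves) (hk : 0 < k) {u : Fin d → ℝ}
    (hu : u ∈ Icc 0 1) (y : ℝ) : L.IsValue d k u y ↔ y = L.nodeValue d u (d + k - 1) := by
  constructor
  · rintro ⟨x, -, hleaf, hfork, rfl⟩
    have : ∀ v, v < d + k → x v = L.nodeValue d u v := by
      intro v
      induction v using Nat.strong_induction_on with
      | _ v ih =>
        intro hv
        by_cases hvd : v < d
        · exact (hleaf ⟨v, hvd⟩).trans (nodeValue_leaf L u ⟨v, hvd⟩).symm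
        · rw [hfork v (not_lt.1 hvd) hv, h.nodeValue_fork u (not_lt.1 hvd), archCopula, archCopula]
          congr 1
          refine Finset.sum_congr rfl fun w hw => ?_
          have hwv := h.child_lt v w hw
          rw [ih w hwv (hwv.trans hv)]
    exact this _ (by omega)
  · rintro rfl
    exact ⟨L.nodeValue d u, fun v hv => h.nodeValue_mem hu hv, nodeValue_leaf L u,
      fun v hv _ => h.nodeValue_fork u hv, rfl⟩

theorem nodeValue_eq_zero (h : L.IsNestedTree d D leaves) {u : Fin d → ℝ} {i : Fin d}
    (hi : u i = 0) {v : ℕ} (hv : v < D) (hiv : i ∈ leaves v) : L.nodeValue d u v = 0 := by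
  induction v using Nat.strong_induction_on with
  | _ v ih =>
    by_cases hvd : v < d
    · have h1 := h.leaves_leaf ⟨v, hvd⟩
      simp only at h1
      rw [h1, Finset.mem_singleton] at hiv
      rw [← hi, hiv]
      exact nodeValue_leaf L u ⟨v, hvd⟩
    · have hvd := not_lt.1 hvd
      obtain ⟨w, hw, hiw⟩ := (h.mem_leaves v hvd hv i).1 hiv
      have hwv := h.child_lt v w hw
      have hs := h.strict v hvd hv
      rw [h.nodeValue_fork u hvd, archCopula, ← hs.map_top]
      congr 1
      refine ENNReal.sum_eq_top.2 ⟨w, hw, ?_⟩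
      rw [ih w hwv (hwv.trans hv) hiw, hs.genInv_zero]

theorem nodeValue_update_one (h : L.IsNestedTree d D leaves) (i : Fin d) {t : ℝ}
    (ht : t ∈ Icc (0 : ℝ) 1) {v : ℕ} (hv : v < D) :
    L.nodeValue d (Function.update 1 i t) v = if i ∈ leaves v then t else 1 := by
  induction v using Nat.strong_induction_on with
  | _ v ih =>
    by_cases hvd : v < d
    · have h1 := h.leaves_leaf ⟨v, hvd⟩
      simp only at h1
      refine (nodeValue_leaf L _ ⟨v, hvd⟩).trans ?_
      simp [Function.update_apply, h1, eq_comm]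
    · have hvd := not_lt.1 hvd
      have hs := h.strict v hvd hv
      rw [h.nodeValue_fork _ hvd, archCopula]
      have hterm : ∀ w ∈ L.children v, genInv (L.lam v)
          (L.nodeValue d (Function.update 1 i t) w) =
          if i ∈ leaves w then genInv (L.lam v) t else 0 := by
        intro w hw
        have hwv := h.child_lt v w hw
        rw [ih w hwv (hwv.trans hv)]
        split_ifs
        · rfl
        · exact hs.genInv_one
      rw [Finset.sum_congr rfl hterm]
      split_ifs with hiv
      · obtain ⟨w, hw, hiw⟩ := (h.mem_leaves v hvd hv i).1 hiv
        rw [Finset.sum_eq_single_of_mem w hw, if_pos hiw, hs.apply_genInv ht]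
        intro w' hw' hne
        exact if_neg (Finset.disjoint_left.1 (h.disjoint v hvd hv w hw w' hw' hne.symm) hiw)
      · rw [Finset.sum_eq_zero, hs.map_zero]
        intro w hw
        exact if_neg fun hiw => hiv ((h.mem_leaves v hvd hv i).2 ⟨w, hw, hiw⟩)

/-- On a box in `(0, 1]^d`, the value of a fork `v` is `λ(v)` of a function on the vertices that has
alternating increments: this function is a sum of functions of one coordinate and of the
corresponding functions of the children, composed with the Bernstein functions
`λ(v)⁻¹ ∘ λ(w)`. -/
theorem exists_cubeCA (h : L.IsNestedTree d D leaves) (l : List (Fin d)) {a b : Fin d → ℝ}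
    (ha : ∀ i, 0 < a i) (hab : a ≤ b) (hb : ∀ i, b i ≤ 1) {v : ℕ} (hdv : d ≤ v) (hv : v < D) :
    ∃ s : Finset (Fin d) → ℝ, (∀ S, 0 ≤ s S) ∧ CubeCA l s ∧
      ∀ S : Finset (Fin d), L.nodeValue d (fun i => if i ∈ S then a i else b i) v =
        L.lam v (ENNReal.ofReal (s S)) := by
  induction v using Nat.strong_induction_on with
  | _ v ih =>
    have hs := h.strict v hdv hv
    have ha' : ∀ i, a i ∈ Ioc (0 : ℝ) 1 := fun i => ⟨ha i, (hab i).trans (hb i)⟩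
    have hb' : ∀ i, b i ∈ Ioc (0 : ℝ) 1 := fun i => ⟨(ha i).trans_le (hab i), hb i⟩
    have hleaf : ∀ w (hw : w < d) (S : Finset (Fin d)),
        L.nodeValue d (fun i => if i ∈ S then a i else b i) w =
          if ⟨w, hw⟩ ∈ S then a ⟨w, hw⟩ else b ⟨w, hw⟩ := fun w hw S =>
      nodeValue_leaf L _ ⟨w, hw⟩
    have hmem : ∀ w ∈ L.children v, ∀ S : Finset (Fin d),
        L.nodeValue d (fun i => if i ∈ S then a i else b i) w ∈ Ioc (0 : ℝ) 1 := by
      intro w hw S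
      have hwv := h.child_lt v w hw
      by_cases hwd : w < d
      · rw [hleaf w hwd]
        split_ifs
        · exact ha' _
        · exact hb' _
      · obtain ⟨s, -, -, hval⟩ := ih w hwv (not_lt.1 hwd) (hwv.trans hv)
        rw [hval]
        exact (h.strict w (not_lt.1 hwd) (hwv.trans hv)).apply_ofReal_mem _
    refine ⟨fun S => ∑ w ∈ L.children v,
      (genInv (L.lam v) (L.nodeValue d (fun i => if i ∈ S then a i else b i) w)).toReal,
      fun S => Finset.sum_nonneg fun w _ => ENNReal.toReal_nonneg, CubeCA.sum fun w hw => ?_,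
      fun S => ?_⟩
    · have hwv := h.child_lt v w hw
      by_cases hwd : w < d
      · have hle : (genInv (L.lam v) (b ⟨w, hwd⟩)).toReal ≤
            (genInv (L.lam v) (a ⟨w, hwd⟩)).toReal :=
          ENNReal.toReal_mono (hs.genInv_ne_top (ha' _)) (hs.genInv_le_genInv
            (Ioc_subset_Icc_self (ha' _)) (Ioc_subset_Icc_self (hb' _)) (hab _))
        convert CubeCA.coordinate (l := l) (⟨w, hwd⟩ : Fin d) hle using 2 with S
        rw [hleaf w hwd]
        split_ifs <;> rfl
      · have hwd := not_lt.1 hwd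
        obtain ⟨s, hnn, hca, hval⟩ := ih w hwv hwd (hwv.trans hv)
        obtain ⟨-, -, hdiff, hcm⟩ := h.nested v hdv hv w hw hwd
        simp only [hval]
        exact CubeCA.comp_bernstein hdiff hcm
          (hs.continuous_link (h.strict w hwd (hwv.trans hv))).continuousOn hca hnn
    · rw [h.nodeValue_fork _ hdv, archCopula,
        ENNReal.ofReal_sum_of_nonneg fun w _ => ENNReal.toReal_nonneg]
      congr 1
      refine Finset.sum_congr rfl fun w hw => ?_
      rw [ENNReal.ofReal_toReal (hs.genInv_ne_top (hmem w hw S))]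

theorem sum_powerset_nonneg (h : L.IsNestedTree d D leaves) (A : Finset (Fin d))
    {a b : Fin d → ℝ} (ha : ∀ i, 0 < a i) (hab : a ≤ b) (hb : ∀ i, b i ≤ 1) {v : ℕ}
    (hdv : d ≤ v) (hv : v < D) :
    0 ≤ ∑ S ∈ A.powerset, (-1 : ℝ) ^ S.card *
      L.nodeValue d (fun i => if i ∈ S then a i else b i) v := by
  obtain ⟨s, hnn, hca, hval⟩ := h.exists_cubeCA A.toList ha hab hb hdv hv
  have hc : Continuous fun t => L.lam v (ENNReal.ofReal t) :=
    (h.strict v hdv hv).continuous.comp ENNReal.continuous_ofReal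
  have hcm := CubeCA.comp_cm (h.cm v hdv hv).2 hc.continuousOn hca hnn
  simp only [hval]
  simpa using CubeCM.sum_powerset_nonneg A.nodup_toList hcm

theorem isCopula (h : L.IsNestedTree d D leaves) {v : ℕ} (hdv : d ≤ v) (hv : v < D)
    (hroot : leaves v = Finset.univ) : IsCopula d (fun u => L.nodeValue d u v) where
  mem_Icc := fun u hu => h.nodeValue_mem hu hv
  grounded := fun u _ i hi => h.nodeValue_eq_zero hi hv (by simp [hroot])
  margin := fun i t ht => by simp [h.nodeValue_update_one i ht hv, hroot]
  increasing := by
    intro a ha b hb hab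
    by_cases hb0 : ∃ i, b i = 0
    · obtain ⟨i, hi⟩ := hb0
      have hai : a i = 0 := le_antisymm ((hab i).trans_eq hi) (ha.1 i)
      refine (Finset.sum_eq_zero fun S _ => ?_).ge
      rw [h.nodeValue_eq_zero (i := i) (by simp [hi, hai]) hv (by simp [hroot]), mul_zero]
    · push Not at hb0
      -- the terms with a zero coordinate vanish; raising the zeros of `a` does not affect the rest
      have key := h.sum_powerset_nonneg (Finset.univ.filter fun i => a i ≠ 0)
        (a := fun i => if a i = 0 then b i else a i) (b := b)
        (fun i => by
          split_ifs with h0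
          · exact lt_of_le_of_ne (hb.1 i) (hb0 i).symm
          · exact lt_of_le_of_ne (ha.1 i) (Ne.symm h0))
        (fun i => by
          dsimp only
          split_ifs
          · exact le_rfl
          · exact hab i)
        (fun i => hb.2 i) hdv hv
      refine key.trans_eq ?_
      rw [← Finset.sum_subset (Finset.subset_univ (Finset.univ.filter fun i => a i ≠ 0).powerset)]
      · refine Finset.sum_congr rfl fun S hS => ?_
        congr 2
        funext i
        by_cases hi : i ∈ S
        · have := (Finset.mem_filter.1 (Finset.mem_powerset.1 hS hi)).2
          simp only [if_pos hi, if_neg this]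
        · simp only [if_neg hi]
      · intro S _ hS
        obtain ⟨i, hi, hi'⟩ := Finset.not_subset.1 fun hsub => hS (Finset.mem_powerset.2 hsub)
        have hai : a i = 0 := by simpa using hi'
        rw [h.nodeValue_eq_zero (i := i) (by simp [hi, hai]) hv (by simp [hroot]), mul_zero]

end IsNestedTree

end LabelledTree

/-! ### The estimated tree -/

/-- The labelled tree of a structure and a labeling. -/
def StructState.tree {d : ℕ} (T : StructState d) (lam : ℕ → ℝ≥0∞ → ℝ) : LabelledTree where
  edges := (Finset.range (d - 1)).biUnion (fun k =>
    {(d + k, (T.joined (d + k)).1), (d + k, (T.joined (d + k)).2)})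
  lam := lam

theorem StructState.mem_children_tree {d : ℕ} {T : StructState d} {lam : ℕ → ℝ≥0∞ → ℝ} {v w : ℕ} :
    w ∈ (T.tree lam).children v ↔
      ∃ k < d - 1, v = d + k ∧ (w = (T.joined (d + k)).1 ∨ w = (T.joined (d + k)).2) := by
  simp only [LabelledTree.children, StructState.tree, Finset.mem_image, Finset.mem_filter,
    Finset.mem_biUnion, Finset.mem_range, Finset.mem_insert, Finset.mem_singleton]
  constructor
  · rintro ⟨e, ⟨⟨k, hk, rfl | rfl⟩, rfl⟩, rfl⟩
    · exact ⟨k, hk, rfl, Or.inl rfl⟩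
    · exact ⟨k, hk, rfl, Or.inr rfl⟩
  · rintro ⟨k, hk, rfl, rfl | rfl⟩
    · exact ⟨_, ⟨⟨k, hk, Or.inl rfl⟩, rfl⟩, rfl⟩
    · exact ⟨_, ⟨⟨k, hk, Or.inr rfl⟩, rfl⟩, rfl⟩

namespace ForestInv

variable {d : ℕ} {T : StructState d} {lam : ℕ → ℝ≥0∞ → ℝ}

theorem children_fork {k : ℕ} (hk : k < d - 1) :
    (T.tree lam).children (d + k) = {(T.joined (d + k)).1, (T.joined (d + k)).2} := by
  ext w
  rw [StructState.mem_children_tree, Finset.mem_insert, Finset.mem_singleton]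
  constructor
  · rintro ⟨k', -, hkk, hw⟩
    rwa [hkk]
  · exact fun hw => ⟨k, hk, rfl, hw⟩

theorem child_lt (h : ForestInv d (d - 1) T) {v w : ℕ} (hw : w ∈ (T.tree lam).children v) :
    w < v := by
  obtain ⟨k, hk, rfl, hw⟩ := StructState.mem_children_tree.1 hw
  have := h.joined_lt k hk
  omega

theorem isHACTree (h : ForestInv d (d - 1) T) (hd : 2 ≤ d)
    (hlam : ∀ v, d ≤ v → v < d + (d - 1) → IsCMGenerator (lam v)) :
    (T.tree lam).IsHACTree d (d - 1) := by
  have hparent : ∀ w < d + (d - 1) - 1, ∃ v, w ∈ (T.tree lam).children v := by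
    intro w hw
    obtain ⟨k, hk, hwk⟩ := h.parent w (by omega)
      (by rw [h.active_eq (by omega), Finset.mem_singleton]; omega)
    exact ⟨d + k, StructState.mem_children_tree.2 ⟨k, hk, rfl, hwk⟩⟩
  refine ⟨?_, ?_, ?_, ?_, ?_, ?_, hlam⟩
  · intro e he
    have hmem : e.2 ∈ (T.tree lam).children e.1 :=
      Finset.mem_image.2 ⟨e, Finset.mem_filter.2 ⟨he, rfl⟩, rfl⟩
    have hlt := h.child_lt hmem
    obtain ⟨k, hk, hv, -⟩ := StructState.mem_children_tree.1 hmem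
    omega
  · intro v hv
    refine Finset.eq_empty_of_forall_notMem fun w hw => ?_
    obtain ⟨k, -, hvk, -⟩ := StructState.mem_children_tree.1 hw
    omega
  · intro v hdv hv
    obtain ⟨k, rfl⟩ := Nat.exists_eq_add_of_le hdv
    rw [children_fork (by omega), Finset.card_pair (h.joined_lt k (by omega)).1.ne]
  · intro v hv
    have hlt := h.child_lt hv
    obtain ⟨k, hk, hvk, -⟩ := StructState.mem_children_tree.1 hv
    omega
  · intro w hw
    obtain ⟨v, hv⟩ := hparent w hw
    refine ⟨v, hv, fun v' hv' => ?_⟩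
    obtain ⟨k, hk, rfl, hwk⟩ := StructState.mem_children_tree.1 hv
    obtain ⟨k', hk', rfl, hwk'⟩ := StructState.mem_children_tree.1 hv'
    rw [h.parent_unique w k hk k' hk' hwk hwk']
  · -- climb from `w` to the root
    have hreach : ∀ j w, w + j = d + (d - 1) - 1 → Relation.ReflTransGen
        (fun v v' => v' ∈ (T.tree lam).children v) (d + (d - 1) - 1) w := by
      intro j
      induction j using Nat.strong_induction_on with
      | _ j ih =>
        intro w hw
        rcases Nat.eq_zero_or_pos j with rfl | hj
        · rw [← hw]; exact Relation.ReflTransGen.refl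
        · obtain ⟨v, hv⟩ := hparent w (by omega)
          have hlt := h.child_lt hv
          obtain ⟨k, hk, hvk, -⟩ := StructState.mem_children_tree.1 hv
          exact (ih (d + (d - 1) - 1 - v) (by omega) v (by omega)).tail hv
    intro w hw
    exact hreach (d + (d - 1) - 1 - w) w (by omega)

theorem isNestedTree (h : ForestInv d (d - 1) T)
    (hstrict : ∀ v, d ≤ v → v < d + (d - 1) → IsStrictGenerator (lam v))
    (hcm : ∀ v, d ≤ v → v < d + (d - 1) → IsCMGenerator (lam v))
    (hnest : ∀ v, d ≤ v → v < d + (d - 1) → ∀ w ∈ (T.tree lam).children v, d ≤ w →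
      Nestable (lam v) (lam w)) :
    (T.tree lam).IsNestedTree d (d + (d - 1)) T.leaves := by
  refine ⟨fun v w hw => h.child_lt hw, h.leaves_leaf, fun v hdv hv i => ?_,
    fun v hdv hv w hw w' hw' hne => ?_, hstrict, hcm, hnest⟩
  · obtain ⟨k, rfl⟩ := Nat.exists_eq_add_of_le hdv
    rw [children_fork (by omega), h.leaves_fork k (by omega)]
    simp
  · obtain ⟨k, rfl⟩ := Nat.exists_eq_add_of_le hdv
    have hdis := h.disjoint_fork k (by omega)
    rw [children_fork (by omega), Finset.mem_insert, Finset.mem_singleton] at hw hw'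
    rcases hw with rfl | rfl <;> rcases hw' with rfl | rfl
    · exact (hne rfl).elim
    · exact hdis
    · exact hdis.symm
    · exact (hne rfl).elim

end ForestInv

end HAC

end

theorem mainTheorem1 (F : Finset HAC.Label)
    (NF : HAC.NRepr) (hNF : HAC.IsFArchimedean F NF)
    (N2 : HAC.Label → ℝ → HAC.NRepr) (hN2 : HAC.IsParentMap F NF N2)
    (N0 : HAC.NRepr) (hN0 : HAC.InSemigroup F N0) (hN0A : HAC.IsArchimedean N0)
    (hne : ∃ a θ, HAC.TMem a θ N0)
    (hcond : ∀ a₂ θ₂ a₃ θ₃, HAC.TMem a₂ θ₂ N0 → HAC.TMem a₃ θ₃ N0 →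
      ∃ a₁ ∈ F, ∃ θ₁ : ℝ, 0 ≤ θ₁ ∧
        HAC.TMem a₁ θ₁ (HAC.tInter (HAC.tInter N0 (N2 a₂ θ₂)) (N2 a₃ θ₃)))
    (d n : ℕ) (hd : 2 ≤ d) (U : Fin n → Fin d → ℝ) (g : HAC.Aggregation) (S : HAC.GoF n)
    (cv : HAC.Conventions) :
    ∃ L : HAC.LabelledTree, HAC.hetEstimate cv U N0 N2 g S = some L ∧
      L.IsHACTree d (d - 1) ∧ L.SNC d (d - 1) ∧
      ∃ C : (Fin d → ℝ) → ℝ, L.IsHACFunction d (d - 1) C ∧ HAC.IsCopula d C := by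
  have hsub : ∀ a θ, HAC.TMem a θ N0 → HAC.TMem a θ NF := hNF.2.2 N0 hN0 hN0A
  have hcp : HAC.HasCommonParents N2 N0 := by
    intro p q hp hq
    obtain ⟨a, -, θ, -, h⟩ := hcond _ _ _ _ hp hq
    rw [HAC.tMem_tInter, HAC.tMem_tInter] at h
    exact ⟨a, θ, h.1.1, h.1.2, h.2⟩
  set T := HAC.structEstimate cv U with hT
  have hinv : HAC.ForestInv d (d - 1) T := HAC.forestInv_structEstimate (by omega) cv U
  obtain ⟨s, hs, hest⟩ := HAC.estimationInv_loop hN2 hNF.2.1 hsub hcp hN0 hne cv U g S T (d - 1)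
    fun k hk => by
      have := hinv.joined_lt k hk
      omega
  set lam : ℕ → ℝ≥0∞ → ℝ := fun v => HAC.psi (s.par v).1 (s.par v).2 with hlam
  have hpar : ∀ v, d ≤ v → v < d + (d - 1) → HAC.TMem (s.par v).1 (s.par v).2 N0 := by
    intro v hdv hv
    obtain ⟨k, rfl⟩ := Nat.exists_eq_add_of_le hdv
    exact hest.par_mem k (by omega)
  have hcm : ∀ v, d ≤ v → v < d + (d - 1) → HAC.IsCMGenerator (lam v) := fun v hdv hv =>
    (hN0A _ _ (hpar v hdv hv)).2
  have hstrict : ∀ v, d ≤ v → v < d + (d - 1) → HAC.IsStrictGenerator (lam v) :=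
    fun v hdv hv => HAC.isStrictGenerator_psi (hN0A _ _ (hpar v hdv hv)).1 (hcm v hdv hv)
  have hnest : ∀ v, d ≤ v → v < d + (d - 1) → ∀ w ∈ (T.tree lam).children v, d ≤ w →
      HAC.Nestable (lam v) (lam w) := by
    intro v hdv hv w hw hdw
    have hwv := hinv.child_lt hw
    obtain ⟨k, hk, rfl, hwk⟩ := HAC.StructState.mem_children_tree.1 hw
    exact (((hN2 _ _ (hsub _ _ (hpar w hdw (hwv.trans hv)))).2 _ _).1
      (hest.nested k hk w hdw hwk)).2.2
  have htree := hinv.isNestedTree hstrict hcm hnest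
  refine ⟨T.tree lam, ?_, hinv.isHACTree hd hcm, fun v hdv hv w hw hdw _ => hnest v hdv hv w hw hdw,
    fun u => (T.tree lam).nodeValue d u (d + (d - 1) - 1),
    fun u hu y => htree.isValue_iff (by omega) hu y,
    htree.isCopula (by omega) (by omega) (hinv.leaves_root (by omega))⟩
  simp only [HAC.hetEstimate, ← hT, hs, Option.map_some]
  rfl
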